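/- Let $M$ be a von Neumann algebra, i.e. a $*$-subalgebra $M\subset B(K)$ ($K$ a complex Hilbert space) which is equal to its bicommutant, viewed as an operator space through this inclusion. Let $\max(M)$ be the maximal operator space on the Banach space $M$, realized by the isometric embedding $$J: M\to B\Big(\bigoplus\nolimits_{v} \mathbb{C}^{d_v}\Big),\qquad J(x)=\bigoplus\nolimits_v v(x),$$ where $v$ runs over all linear contractions $v: M\to B(\mathbb{C}^{d_v})$, $d_v\in\mathbb{N}$, and $\bigoplus_v$ is the Hilbertian direct sum. Call $M$ remotely injective if for some Hilbert space $H$ there are linear maps $u: M\to B(H)$ and $v: B(H)\to M$ with $vu=Id_M$, $u$ normal (i.e. continuous for the ultraweak topologies), $\|u\|\le 1$ and $\|v\|_{cb}\le 1$. Then the identity map of $M$ defines a complete contraction $\Phi:\max(M)\to M$, and $M$ is remotely injective if and only if $\Phi$ factors completely contractively through some $B(H)$, i.e. if and only if there are a Hilbert space $H$ and linear maps $u:\max(M)\to B(H)$, $v: B(H)\to M$ with $\|u\|_{cb}\le 1$, $\|v\|_{cb}\le 1$ and $vu=\Phi$. -/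

import Mathlib

universe u

namespace OpSpace

/-- An `n × n` matrix of bounded operators on `H`, as a bounded operator on the Hilbert space
direct sum `ℓ²ₙ(H)`: `(a ξ) i = ∑ j, a i j (ξ j)`. -/
noncomputable def blockOp {H : Type*} [NormedAddCommGroup H] [InnerProductSpace ℂ H] {n : ℕ}
    (a : Matrix (Fin n) (Fin n) (H →L[ℂ] H)) :
    PiLp 2 (fun _ : Fin n => H) →L[ℂ] PiLp 2 (fun _ : Fin n => H) :=
  ((PiLp.continuousLinearEquiv 2 ℂ (fun _ : Fin n => H)).symm :
      (Fin n → H) →L[ℂ] PiLp 2 (fun _ : Fin n => H)) ∘L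
    ContinuousLinearMap.pi
      (fun i => ∑ j, (a i j) ∘L (PiLp.proj 2 (fun _ : Fin n => H) j))

theorem blockOp_apply {H : Type*} [NormedAddCommGroup H] [InnerProductSpace ℂ H] {n : ℕ}
    (a : Matrix (Fin n) (Fin n) (H →L[ℂ] H)) (ξ : PiLp 2 (fun _ : Fin n => H)) (i : Fin n) :
    blockOp a ξ i = ∑ j, a i j (ξ j) := by
  simp [blockOp]

/-- An operator space is a normed space `X` together with a linear isometric embedding
`J : X → B(H)`; this is the norm of `M_n(X)` that comes with it, namely the one inherited from
`M_n(B(H)) = B(ℓ²ₙ(H))`. -/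
noncomputable def matNorm {X H : Type*} [NormedAddCommGroup X] [NormedSpace ℂ X]
    [NormedAddCommGroup H] [InnerProductSpace ℂ H] (J : X →ₗᵢ[ℂ] (H →L[ℂ] H)) {n : ℕ}
    (x : Matrix (Fin n) (Fin n) X) : ℝ :=
  ‖blockOp (x.map J)‖

/-- `T` is completely contractive (`‖T‖_cb ≤ 1`) from the operator space `(X, J)` to the operator
space `(Y, J')`. -/
def IsCompleteContraction {X H Y H' : Type*} [NormedAddCommGroup X] [NormedSpace ℂ X]
    [NormedAddCommGroup H] [InnerProductSpace ℂ H]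
    [NormedAddCommGroup Y] [NormedSpace ℂ Y]
    [NormedAddCommGroup H'] [InnerProductSpace ℂ H']
    (J : X →ₗᵢ[ℂ] (H →L[ℂ] H)) (J' : Y →ₗᵢ[ℂ] (H' →L[ℂ] H')) (T : X →L[ℂ] Y) : Prop :=
  ∀ (n : ℕ) (x : Matrix (Fin n) (Fin n) X), matNorm J' (x.map T) ≤ matNorm J x

/-- The operator space `B(H)`. -/
noncomputable def fullOS (H : Type*) [NormedAddCommGroup H] [InnerProductSpace ℂ H] :
    (H →L[ℂ] H) →ₗᵢ[ℂ] (H →L[ℂ] H) :=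
  LinearIsometry.id

/-- A von Neumann algebra on `K` as an operator space: the inclusion `M ⊆ B(K)`. -/
def vNOS {K : Type*} [NormedAddCommGroup K] [InnerProductSpace ℂ K] [CompleteSpace K]
    (M : VonNeumannAlgebra K) : M.toStarSubalgebra →ₗᵢ[ℂ] (K →L[ℂ] K) where
  toFun x := x
  map_add' _ _ := rfl
  map_smul' _ _ := rfl
  norm_map' _ := rfl

/-- The contractions from `X` to `B(ℂᵈ)`, for all `d`. -/
abbrev FinContraction (X : Type u) [NormedAddCommGroup X] [NormedSpace ℂ X] : Type u :=
  Σ d : ℕ, {v : X →L[ℂ] (EuclideanSpace ℂ (Fin d) →L[ℂ] EuclideanSpace ℂ (Fin d)) // ‖v‖ ≤ 1}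

/-- The Hilbert space direct sum of the spaces on which the contractions from `X` to `B(ℂᵈ)`
take their values. -/
abbrev MaxSpace (X : Type u) [NormedAddCommGroup X] [NormedSpace ℂ X] : Type u :=
  lp (fun v : FinContraction X => EuclideanSpace ℂ (Fin v.1)) 2

theorem norm_finContraction_apply_le {X : Type u} [NormedAddCommGroup X] [NormedSpace ℂ X]
    (x : X) (v : FinContraction X) : ‖v.2.1 x‖ ≤ ‖x‖ := by
  simpa using v.2.1.le_of_opNorm_le v.2.2 x

/-- The block diagonal operator `⨁ v, v x`. -/
noncomputable def maxOp {X : Type u} [NormedAddCommGroup X] [NormedSpace ℂ X] (x : X) :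
    MaxSpace X →L[ℂ] MaxSpace X :=
  lp.mapCLM 2 (fun v : FinContraction X => v.2.1 x) (norm_nonneg x)
    (norm_finContraction_apply_le x)

theorem maxOp_apply {X : Type u} [NormedAddCommGroup X] [NormedSpace ℂ X] (x : X)
    (ξ : MaxSpace X) (v : FinContraction X) : maxOp x ξ v = v.2.1 x (ξ v) := rfl

theorem norm_maxOp {X : Type u} [NormedAddCommGroup X] [NormedSpace ℂ X] (x : X) :
    ‖maxOp x‖ = ‖x‖ := by
  classical
  apply le_antisymm
  · exact lp.norm_mapCLM_le 2 _ (norm_nonneg x) (norm_finContraction_apply_le x)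
  · obtain ⟨f, hf, hfx⟩ := exists_dual_vector'' ℂ x
    let v : FinContraction X := ⟨1, f.smulRight (ContinuousLinearMap.id ℂ _), by
      rw [ContinuousLinearMap.norm_smulRight_apply]
      exact mul_le_one₀ hf (norm_nonneg _) ContinuousLinearMap.norm_id_le⟩
    let e : EuclideanSpace ℂ (Fin v.1) := EuclideanSpace.single (0 : Fin 1) 1
    have he : ‖e‖ = 1 := by simp [e]
    let ξ : MaxSpace X := lp.single 2 v e
    have hξ : ‖ξ‖ = 1 := by rw [lp.norm_single (by norm_num), he]
    have h1 : ‖maxOp x ξ v‖ ≤ ‖maxOp x‖ := by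
      calc ‖maxOp x ξ v‖ ≤ ‖maxOp x ξ‖ := lp.norm_apply_le_norm (by norm_num) _ _
        _ ≤ ‖maxOp x‖ * ‖ξ‖ := (maxOp x).le_opNorm ξ
        _ = ‖maxOp x‖ := by rw [hξ, mul_one]
    have h2 : maxOp x ξ v = (‖x‖ : ℂ) • e := by
      rw [maxOp_apply, lp.single_apply_self]
      exact congrArg (fun c : ℂ => c • e) hfx
    rw [h2, norm_smul, he, mul_one] at h1
    simpa using h1

/-- The maximal operator space `max(X)`: the space `X` embedded in `B(⨁ v, ℂ^(d v))` by
`x ↦ ⨁ v, v x`, where `v` runs through all contractions from `X` to some `B(ℂᵈ)`. -/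
noncomputable def maxOS (X : Type u) [NormedAddCommGroup X] [NormedSpace ℂ X] :
    X →ₗᵢ[ℂ] (MaxSpace X →L[ℂ] MaxSpace X) where
  toFun := maxOp
  map_add' x y := by
    ext ξ v : 3
    simp [maxOp_apply]
  map_smul' c x := by
    ext ξ v : 3
    simp [maxOp_apply]
  norm_map' := norm_maxOp

/-- The ultraweak (= weak*) topology of `B(H)`: the coarsest one that makes all functionals
`T ↦ ∑ k, ⟪ξ k, T (η k)⟫` with square-summable sequences `ξ`, `η` in `H` continuous. -/
noncomputable abbrev ultraweakTopology (H : Type*) [NormedAddCommGroup H] [InnerProductSpace ℂ H] :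
    TopologicalSpace (H →L[ℂ] H) :=
  ⨅ (ξ : lp (fun _ : ℕ => H) 2) (η : lp (fun _ : ℕ => H) 2),
    TopologicalSpace.induced (fun T : H →L[ℂ] H => ∑' k, inner ℂ (ξ k) (T (η k))) inferInstance

/-- A linear map `M → B(H)` is normal if it is continuous for the ultraweak topologies. -/
def IsNormalMap {K H : Type*} [NormedAddCommGroup K] [InnerProductSpace ℂ K] [CompleteSpace K]
    [NormedAddCommGroup H] [InnerProductSpace ℂ H]
    (M : VonNeumannAlgebra K) (w : M.toStarSubalgebra →L[ℂ] (H →L[ℂ] H)) : Prop :=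
  @Continuous _ _ (TopologicalSpace.induced Subtype.val (ultraweakTopology K))
    (ultraweakTopology H) w

/-- `M` is remotely injective: `Id_M = v ∘ w` with `w : M → B(H)` normal and contractive and
`v : B(H) → M` completely contractive, for some Hilbert space `H`. -/
def RemotelyInjective {K : Type u} [NormedAddCommGroup K] [InnerProductSpace ℂ K]
    [CompleteSpace K] (M : VonNeumannAlgebra K) : Prop :=
  ∃ (H : Type u) (_ : NormedAddCommGroup H) (_ : InnerProductSpace ℂ H) (_ : CompleteSpace H)
    (w : M.toStarSubalgebra →L[ℂ] (H →L[ℂ] H)) (v : (H →L[ℂ] H) →L[ℂ] M.toStarSubalgebra),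
    IsNormalMap M w ∧ ‖w‖ ≤ 1 ∧ IsCompleteContraction (fullOS H) (vNOS M) v ∧
      v ∘L w = ContinuousLinearMap.id ℂ M.toStarSubalgebra

/-- A map `T` between operator spaces `(X, J)` and `(Y, J')` factors completely contractively
through `B(H)` for some Hilbert space `H`. -/
def FactorsThroughBH {X K Y K' : Type u} [NormedAddCommGroup X] [NormedSpace ℂ X]
    [NormedAddCommGroup K] [InnerProductSpace ℂ K]
    [NormedAddCommGroup Y] [NormedSpace ℂ Y]
    [NormedAddCommGroup K'] [InnerProductSpace ℂ K']
    (J : X →ₗᵢ[ℂ] (K →L[ℂ] K)) (J' : Y →ₗᵢ[ℂ] (K' →L[ℂ] K')) (T : X →L[ℂ] Y) : Prop :=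
  ∃ (H : Type u) (_ : NormedAddCommGroup H) (_ : InnerProductSpace ℂ H) (_ : CompleteSpace H)
    (w : X →L[ℂ] (H →L[ℂ] H)) (v : (H →L[ℂ] H) →L[ℂ] Y),
    IsCompleteContraction J (fullOS H) w ∧ IsCompleteContraction (fullOS H) J' v ∧ v ∘L w = T

/-- The natural map `Φ : max(M) → M`, given by the identity of `M`. -/
noncomputable def naturalMap {K : Type*} [NormedAddCommGroup K] [InnerProductSpace ℂ K]
    [CompleteSpace K] (M : VonNeumannAlgebra K) :
    M.toStarSubalgebra →L[ℂ] M.toStarSubalgebra :=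
  ContinuousLinearMap.id ℂ M.toStarSubalgebra

end OpSpace

/-!
A contraction `u : X → B(H)` is completely contractive on `max(X)`
(`OpSpace.isCompleteContraction_maxOS`): the norm of a matrix `(u (x k l))` is computed by
finitely many vectors of `H`, and the compression of `u` to their span is one of the summands of
the embedding of `max(X)`. Hence `Φ` is a complete contraction, and the factorization that makes
`M` remotely injective is also a factorization of `Φ`.

Conversely, let `Φ = v ∘ u` with `u : max(M) → B(H)` and `v : B(H) → M` completely contractive.
Only the normality of `u` is missing. Let `M_*` be the closed span of the vector functionals
`⟪ζ, · θ⟫` in the dual of `M`. A bounded functional on `M_*` is a bounded sesquilinear form of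
`(ζ, θ)`, so it is given by an operator, which commutes with the commutant of `M` and thus lies in `M`.
This makes `M` the dual of `M_*` (`OpSpace.isPredual_predual`). The same argument shows that the
map from `ℓ¹` to the dual of `M` which sums series of vector functionals has closed range, so that
every element of `M_*` is such a series and is ultraweakly continuous
(`OpSpace.exists_lp_of_mem_predual`).

Because `M` is a dual space, local reflexivity applies: a contraction from `M` to a
finite-dimensional space satisfies every linear inequality that holds for the contractions with
coefficients in `M_*` (`OpSpace.re_sum_apply_le_of_forall_coordSubmodule`). By the Hahn-Banach
theorem, `u` is then the limit, pointwise in the weak operator topology and along an ultrafilter,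
of the contractions `w : M → B(H)` whose coefficients `⟪ξ, w(·) η⟫` are in `M_*`
(`OpSpace.exists_ultrafilter_tendsto_coeffContraction`).

The direct sum `W` of all these `w` is a contraction to `B(ℓ²(ι, H))`. Its coefficients are norm
convergent sums of elements of `M_*`, so it is normal
(`OpSpace.isNormalMap_of_coeff_mem_predual`). The map `Ψ` that takes an operator on `ℓ²(ι, H)` to
the limit of its diagonal entries along the ultrafilter is completely contractive, as a weak limit
of compressions, and `Ψ ∘ W = u`. So `v ∘ Ψ` and `W` show that `M` is remotely injective. No
extension theorem for completely contractive maps is needed.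
-/

namespace OpSpace

open Filter Topology
open scoped InnerProductSpace

/-! ### Matrices of operators -/

section BlockOperators

variable {H : Type*} [NormedAddCommGroup H] [InnerProductSpace ℂ H]

theorem opNorm_le_of_forall_norm_inner_le {T : H →L[ℂ] H} {C : ℝ} (hC : 0 ≤ C)
    (h : ∀ ξ η : H, ‖⟪ξ, T η⟫_ℂ‖ ≤ C * ‖ξ‖ * ‖η‖) : ‖T‖ ≤ C := by
  refine T.opNorm_le_bound hC fun η => ?_
  rcases eq_or_ne (T η) 0 with h0 | h0
  · rw [h0, norm_zero]
    positivity
  · have h1 := h (T η) η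
    rw [inner_self_eq_norm_sq_to_K] at h1
    simp only [norm_pow, RCLike.norm_ofReal, abs_norm] at h1
    have h2 : 0 < ‖T η‖ := norm_pos_iff.2 h0
    nlinarith

theorem inner_blockOp {n : ℕ} (a : Matrix (Fin n) (Fin n) (H →L[ℂ] H))
    (ξ η : PiLp 2 (fun _ : Fin n => H)) :
    ⟪ξ, blockOp a η⟫_ℂ = ∑ k, ∑ l, ⟪ξ k, a k l (η l)⟫_ℂ := by
  simp only [PiLp.inner_apply, blockOp_apply, inner_sum]

theorem norm_sum_inner_le {n : ℕ} (a : Matrix (Fin n) (Fin n) (H →L[ℂ] H)) (ξ η : Fin n → H) :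
    ‖∑ k, ∑ l, ⟪ξ k, a k l (η l)⟫_ℂ‖ ≤
      ‖blockOp a‖ * √(∑ k, ‖ξ k‖ ^ 2) * √(∑ l, ‖η l‖ ^ 2) := by
  have h := norm_inner_le_norm (𝕜 := ℂ) (WithLp.toLp 2 ξ : PiLp 2 (fun _ : Fin n => H))
    (blockOp a (WithLp.toLp 2 η))
  rw [inner_blockOp] at h
  have h1 := (blockOp a).le_opNorm (WithLp.toLp 2 η)
  have h2 : ‖(WithLp.toLp 2 ξ : PiLp 2 (fun _ : Fin n => H))‖ = √(∑ k, ‖ξ k‖ ^ 2) := by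
    rw [PiLp.norm_eq_of_L2]
  have h3 : ‖(WithLp.toLp 2 η : PiLp 2 (fun _ : Fin n => H))‖ = √(∑ k, ‖η k‖ ^ 2) := by
    rw [PiLp.norm_eq_of_L2]
  rw [h3] at h1
  rw [h2] at h
  calc _ ≤ √(∑ k, ‖ξ k‖ ^ 2) * ‖blockOp a (WithLp.toLp 2 η)‖ := h
    _ ≤ √(∑ k, ‖ξ k‖ ^ 2) * (‖blockOp a‖ * √(∑ l, ‖η l‖ ^ 2)) := by gcongr
    _ = _ := by ring

theorem norm_blockOp_le {n : ℕ} {a : Matrix (Fin n) (Fin n) (H →L[ℂ] H)} {C : ℝ} (hC : 0 ≤ C)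
    (h : ∀ ξ η : Fin n → H, ‖∑ k, ∑ l, ⟪ξ k, a k l (η l)⟫_ℂ‖ ≤
      C * √(∑ k, ‖ξ k‖ ^ 2) * √(∑ l, ‖η l‖ ^ 2)) : ‖blockOp a‖ ≤ C := by
  refine opNorm_le_of_forall_norm_inner_le hC fun ξ η => ?_
  rw [inner_blockOp, PiLp.norm_eq_of_L2, PiLp.norm_eq_of_L2]
  exact h ξ η

end BlockOperators

/-! ### Complete contractions -/

section CompleteContractions

variable {X H Y H' Z H'' : Type*} [NormedAddCommGroup X] [NormedSpace ℂ X]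
  [NormedAddCommGroup H] [InnerProductSpace ℂ H]
  [NormedAddCommGroup Y] [NormedSpace ℂ Y] [NormedAddCommGroup H'] [InnerProductSpace ℂ H']
  [NormedAddCommGroup Z] [NormedSpace ℂ Z] [NormedAddCommGroup H''] [InnerProductSpace ℂ H'']

theorem IsCompleteContraction.comp {J : X →ₗᵢ[ℂ] (H →L[ℂ] H)} {J' : Y →ₗᵢ[ℂ] (H' →L[ℂ] H')}
    {J'' : Z →ₗᵢ[ℂ] (H'' →L[ℂ] H'')} {S : Y →L[ℂ] Z} {T : X →L[ℂ] Y}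
    (hS : IsCompleteContraction J' J'' S) (hT : IsCompleteContraction J J' T) :
    IsCompleteContraction J J'' (S ∘L T) := fun n x =>
  (hS n (x.map T)).trans (hT n x)

/-- A complete contraction is a contraction: this is the case of `1 × 1` matrices. -/
theorem IsCompleteContraction.norm_le_one {J : X →ₗᵢ[ℂ] (H →L[ℂ] H)}
    {J' : Y →ₗᵢ[ℂ] (H' →L[ℂ] H')} {T : X →L[ℂ] Y} (hT : IsCompleteContraction J J' T) :
    ‖T‖ ≤ 1 := by
  refine T.opNorm_le_bound zero_le_one fun x => ?_
  have h1 : matNorm J (Matrix.of fun _ _ : Fin 1 => x) ≤ ‖J x‖ := by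
    refine norm_blockOp_le (norm_nonneg _) fun ξ η => ?_
    simp only [Finset.univ_unique, Finset.sum_singleton, Matrix.map_apply, Matrix.of_apply,
      Real.sqrt_sq (norm_nonneg _)]
    calc _ ≤ ‖ξ default‖ * ‖J x (η default)‖ := norm_inner_le_norm _ _
      _ ≤ ‖ξ default‖ * (‖J x‖ * ‖η default‖) := by gcongr; exact (J x).le_opNorm _
      _ = _ := by ring
  have h2 : ‖J' (T x)‖ ≤ matNorm J' ((Matrix.of fun _ _ : Fin 1 => x).map T) := by
    unfold matNorm
    refine opNorm_le_of_forall_norm_inner_le (by positivity) fun ξ η => ?_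
    have := norm_sum_inner_le (((Matrix.of fun _ _ : Fin 1 => x).map T).map J')
      (fun _ => ξ) (fun _ => η)
    simpa only [Finset.univ_unique, Finset.sum_singleton, Matrix.map_apply, Matrix.of_apply,
      Real.sqrt_sq (norm_nonneg _)] using this
  rw [one_mul, ← J'.norm_map, ← J.norm_map]
  exact h2.trans ((hT 1 _).trans h1)

end CompleteContractions

/-! ### Contractions on the maximal operator space -/

section Conjugation

variable {G H : Type*} [NormedAddCommGroup G] [InnerProductSpace ℂ G] [CompleteSpace G]
  [NormedAddCommGroup H] [InnerProductSpace ℂ H] [CompleteSpace H]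

/-- The map `T ↦ A T A†` from `B(H)` to `B(G)`. It is a compression if `A†` is an isometry. -/
noncomputable def conjCLM (A : H →L[ℂ] G) : (H →L[ℂ] H) →L[ℂ] (G →L[ℂ] G) :=
  ContinuousLinearMap.compL ℂ G H G A ∘L
    (ContinuousLinearMap.compL ℂ G H H).flip (ContinuousLinearMap.adjoint A)

theorem inner_conjCLM (A : H →L[ℂ] G) (T : H →L[ℂ] H) (α β : G) :
    ⟪α, conjCLM A T β⟫_ℂ =
      ⟪ContinuousLinearMap.adjoint A α, T (ContinuousLinearMap.adjoint A β)⟫_ℂ :=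
  (ContinuousLinearMap.adjoint_inner_left A _ _).symm

theorem norm_conjCLM_le_one {A : H →L[ℂ] G} (hA : ‖A‖ ≤ 1) : ‖conjCLM A‖ ≤ 1 := by
  have hA' : ‖ContinuousLinearMap.adjoint A‖ ≤ 1 := by rwa [LinearIsometryEquiv.norm_map]
  refine ContinuousLinearMap.opNorm_le_bound _ zero_le_one fun T => ?_
  calc ‖A ∘L (T ∘L ContinuousLinearMap.adjoint A)‖
      ≤ ‖A‖ * (‖T‖ * ‖ContinuousLinearMap.adjoint A‖) :=
        (ContinuousLinearMap.opNorm_comp_le _ _).trans (by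
          gcongr; exact ContinuousLinearMap.opNorm_comp_le _ _)
    _ ≤ 1 * (‖T‖ * 1) := by gcongr
    _ = 1 * ‖T‖ := by ring

end Conjugation

/-- Every contraction from `X` to an operator space is completely contractive on `max(X)`: the
matrix coefficients that compute the norm only involve the compression of the contraction to a
finite-dimensional subspace, and this compression is one of the summands of `maxOp`. -/
theorem isCompleteContraction_maxOS {X : Type u} [NormedAddCommGroup X] [NormedSpace ℂ X]
    {Y H : Type*} [NormedAddCommGroup Y] [NormedSpace ℂ Y]
    [NormedAddCommGroup H] [InnerProductSpace ℂ H] [CompleteSpace H]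
    (J' : Y →ₗᵢ[ℂ] (H →L[ℂ] H)) (T : X →L[ℂ] Y) (hT : ‖T‖ ≤ 1) :
    IsCompleteContraction (maxOS X) J' T := by
  classical
  intro n x
  refine norm_blockOp_le (norm_nonneg _) fun ξ η => ?_
  let E : Submodule ℂ H := Submodule.span ℂ (Set.range ξ ∪ Set.range η)
  have : FiniteDimensional ℂ E :=
    FiniteDimensional.span_of_finite ℂ ((Set.finite_range ξ).union (Set.finite_range η))
  let b := stdOrthonormalBasis ℂ E
  let V : EuclideanSpace ℂ (Fin (Module.finrank ℂ E)) →ₗᵢ[ℂ] H :=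
    E.subtypeₗᵢ.comp b.repr.symm.toLinearIsometry
  have hV : ∀ ζ ∈ E, ∃ α, V α = ζ := fun ζ hζ => ⟨b.repr ⟨ζ, hζ⟩, by simp [V]⟩
  choose α hα using fun k => hV (ξ k) (Submodule.subset_span (Or.inl ⟨k, rfl⟩))
  choose β hβ using fun k => hV (η k) (Submodule.subset_span (Or.inr ⟨k, rfl⟩))
  -- the compression of `T` to `E` is a summand `v` of the embedding of `max(X)`
  let c := conjCLM (ContinuousLinearMap.adjoint V.toContinuousLinearMap)
  have hc : ‖c‖ ≤ 1 := norm_conjCLM_le_one (by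
    rw [LinearIsometryEquiv.norm_map]; exact V.norm_toContinuousLinearMap_le)
  have hJ' : ‖J'.toContinuousLinearMap‖ ≤ 1 := J'.norm_toContinuousLinearMap_le
  let v : FinContraction X := ⟨Module.finrank ℂ E, c ∘L J'.toContinuousLinearMap ∘L T, by
    calc _ ≤ ‖c‖ * (‖J'.toContinuousLinearMap‖ * ‖T‖) :=
          (ContinuousLinearMap.opNorm_comp_le _ _).trans (by
            gcongr; exact ContinuousLinearMap.opNorm_comp_le _ _)
      _ ≤ 1 * (1 * 1) := by gcongr
      _ = 1 := by norm_num⟩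
  have h := norm_sum_inner_le (x.map (maxOS X)) (fun k => (lp.single 2 v (α k) : MaxSpace X))
    (fun k => (lp.single 2 v (β k) : MaxSpace X))
  have hkl : ∀ k l, ⟪(lp.single 2 v (α k) : MaxSpace X),
      (x.map (maxOS X)) k l (lp.single 2 v (β l) : MaxSpace X)⟫_ℂ =
      ⟪ξ k, ((x.map T).map J') k l (η l)⟫_ℂ := by
    intro k l
    rw [lp.inner_single_left, Matrix.map_apply, Matrix.map_apply, Matrix.map_apply]
    change ⟪α k, maxOp (x k l) (lp.single 2 v (β l)) v⟫_ℂ = _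
    rw [maxOp_apply, lp.single_apply_self, ← hα, ← hβ]
    refine (inner_conjCLM _ _ _ _).trans ?_
    rw [ContinuousLinearMap.adjoint_adjoint]
    rfl
  simp only [hkl] at h
  have h1 : ∀ k, ‖(lp.single 2 v (α k) : MaxSpace X)‖ = ‖ξ k‖ := fun k => by
    rw [lp.norm_single (by norm_num), ← hα, V.norm_map]
  have h2 : ∀ k, ‖(lp.single 2 v (β k) : MaxSpace X)‖ = ‖η k‖ := fun k => by
    rw [lp.norm_single (by norm_num), ← hβ, V.norm_map]
  simp only [h1, h2] at h
  exact h

/-! ### Closed subspaces and bounded forms -/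

section ClosedRange

/-- A closed range theorem: a bounded operator `f` on a Banach space has closed range as soon as
every functional that vanishes on `ker f` is bounded through `f`; indeed then `f` induces
an antilipschitz map on the quotient by `ker f`. -/
theorem isClosed_range_of_forall_dual {G Z : Type*} [NormedAddCommGroup G] [NormedSpace ℂ G]
    [CompleteSpace G] [NormedAddCommGroup Z] [NormedSpace ℂ Z] (f : G →L[ℂ] Z)
    (h : ∀ l : StrongDual ℂ G, ‖l‖ ≤ 1 → (∀ g, f g = 0 → l g = 0) → ∀ g, ‖l g‖ ≤ ‖f g‖) :
    IsClosed (Set.range f) := by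
  let N : Submodule ℂ G := f.ker
  have hN : IsClosed (N : Set G) := f.isClosed_ker
  have : IsClosed (N.toAddSubgroup : Set G) := hN
  have : CompleteSpace (G ⧸ N) := inferInstance
  let F : (G ⧸ N) →ₗ[ℂ] Z := N.liftQ f.toLinearMap le_rfl
  let q : G →L[ℂ] G ⧸ N := LinearMap.mkContinuous N.mkQ 1 fun g => by
    rw [one_mul]; exact Submodule.Quotient.norm_mk_le N g
  have hq : ‖q‖ ≤ 1 := LinearMap.mkContinuous_norm_le _ zero_le_one _
  have key : ∀ g : G, ‖q g‖ ≤ ‖f g‖ := fun g => by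
    obtain ⟨l, hl, hlg⟩ := exists_dual_vector'' ℂ (q g)
    have h1 := h (l ∘L q) ((ContinuousLinearMap.opNorm_comp_le _ _).trans
      (mul_le_one₀ hl (norm_nonneg _) hq)) (fun g hg => by
        have : q g = 0 := (Submodule.Quotient.mk_eq_zero N).2 hg
        simp [this]) g
    simpa [hlg] using h1
  have hF : AntilipschitzWith 1 F := AddMonoidHomClass.antilipschitz_of_bound F fun y => by
    obtain ⟨g, rfl⟩ := N.mkQ_surjective y
    rw [NNReal.coe_one, one_mul]
    exact key g
  have hFc : UniformContinuous F := by
    have : Continuous F :=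
      (QuotientAddGroup.isQuotientMap_mk (N := N.toAddSubgroup)).continuous_iff.2 f.continuous
    exact uniformContinuous_of_continuousAt_zero F this.continuousAt
  have hr : Set.range F = Set.range f := by
    have h1 : LinearMap.range F = LinearMap.range f.toLinearMap := N.range_liftQ _ _
    exact congrArg (fun S : Submodule ℂ Z => (S : Set Z)) h1
  rw [← hr]
  exact hF.isClosed_range hFc

/-- A bounded functional on the closed span of `S` is determined by its values on `S`. -/
theorem eq_of_eqOn_span_of_bound {E : Type*} [NormedAddCommGroup E] [NormedSpace ℂ E] (S : Set E)
    (y : (Submodule.span ℂ S).topologicalClosure →ₗ[ℂ] ℂ) (z : StrongDual ℂ E) {C : ℝ}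
    (hy : ∀ φ, ‖y φ‖ ≤ C * ‖(φ : E)‖)
    (h : ∀ φ (hφ : φ ∈ S),
      y ⟨φ, Submodule.le_topologicalClosure _ (Submodule.subset_span hφ)⟩ = z φ)
    (φ : (Submodule.span ℂ S).topologicalClosure) : y φ = z φ := by
  have hyc : Continuous y := AddMonoidHomClass.continuous_of_bound y C hy
  have hcl : IsClosed {φ | y φ = z φ} := isClosed_eq hyc (z.continuous.comp continuous_subtype_val)
  have hS : ∀ φ (hφ : φ ∈ Submodule.span ℂ S),
      y ⟨φ, Submodule.le_topologicalClosure _ hφ⟩ = z φ := by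
    intro φ hφ
    induction hφ using Submodule.span_induction with
    | mem φ hφ => exact h φ hφ
    | zero => exact (map_zero y).trans (map_zero z).symm
    | add φ ψ hφ hψ h1 h2 => rw [map_add, ← h1, ← h2, ← map_add]; rfl
    | smul c φ hφ h1 => rw [map_smul, ← h1, ← map_smul]; rfl
  obtain ⟨φ, hφ⟩ := φ
  obtain ⟨s, hs, hlim⟩ := mem_closure_iff_seq_limit.1
    (show φ ∈ closure (Submodule.span ℂ S : Set E) from hφ)
  have hlim' : Filter.Tendsto
      (fun n => (⟨s n, Submodule.le_topologicalClosure _ (hs n)⟩ :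
        (Submodule.span ℂ S).topologicalClosure)) Filter.atTop (nhds ⟨φ, hφ⟩) :=
    tendsto_subtype_rng.2 hlim
  exact hcl.mem_of_tendsto hlim' (Filter.Eventually.of_forall fun n => hS _ (hs n))

end ClosedRange

/-- A bounded sesquilinear form on a Hilbert space is the form of a bounded operator. -/
theorem exists_clm_forall_inner_eq {H : Type*} [NormedAddCommGroup H] [InnerProductSpace ℂ H]
    [CompleteSpace H] (F : H → H → ℂ) (hadd_left : ∀ ζ ζ' θ, F (ζ + ζ') θ = F ζ θ + F ζ' θ)
    (hsmul_left : ∀ (c : ℂ) ζ θ, F (c • ζ) θ = starRingEnd ℂ c * F ζ θ)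
    (hadd_right : ∀ ζ θ θ', F ζ (θ + θ') = F ζ θ + F ζ θ')
    (hsmul_right : ∀ (c : ℂ) ζ θ, F ζ (c • θ) = c * F ζ θ) {C : ℝ} (hC : 0 ≤ C)
    (hF : ∀ ζ θ, ‖F ζ θ‖ ≤ C * ‖ζ‖ * ‖θ‖) :
    ∃ T : H →L[ℂ] H, ‖T‖ ≤ C ∧ ∀ ζ θ, ⟪ζ, T θ⟫_ℂ = F ζ θ := by
  let B : H →L⋆[ℂ] H →L[ℂ] ℂ := LinearMap.mkContinuous₂
    (LinearMap.mk₂'ₛₗ (starRingEnd ℂ) (RingHom.id ℂ) F hadd_left hsmul_left hadd_right hsmul_right)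
    C hF
  let T : H →L[ℂ] H := ContinuousLinearMap.adjoint (InnerProductSpace.continuousLinearMapOfBilin B)
  have hT : ∀ ζ θ, ⟪ζ, T θ⟫_ℂ = F ζ θ := fun ζ θ => by
    rw [ContinuousLinearMap.adjoint_inner_right,
      InnerProductSpace.continuousLinearMapOfBilin_apply]
    rfl
  exact ⟨T, opNorm_le_of_forall_norm_inner_le hC fun ζ θ => by rw [hT]; exact hF ζ θ, hT⟩

/-! ### The predual of a von Neumann algebra -/

section Predual

/-- A space `P` of functionals on `X` is a predual of `X` if it separates the points of `X` and
every bounded functional on `P` is the evaluation at an element of `X` whose norm is at most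
the bound. -/
structure IsPredual {X : Type*} [NormedAddCommGroup X] [NormedSpace ℂ X]
    (P : Submodule ℂ (StrongDual ℂ X)) : Prop where
  exists_eval_eq : ∀ (y : P →ₗ[ℂ] ℂ) {C : ℝ}, 0 ≤ C →
    (∀ φ : P, ‖y φ‖ ≤ C * ‖(φ : StrongDual ℂ X)‖) → ∃ x : X, ‖x‖ ≤ C ∧ ∀ φ : P, y φ = φ.1 x
  eq_zero_of_forall : ∀ x : X, (∀ φ ∈ P, φ x = 0) → x = 0

variable {K : Type*} [NormedAddCommGroup K] [InnerProductSpace ℂ K] [CompleteSpace K]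
  (M : VonNeumannAlgebra K)

/-- The vector functional `x ↦ ⟪ζ, x θ⟫` on a von Neumann algebra. -/
noncomputable def vectorFunctional (ζ θ : K) : StrongDual ℂ M.toStarSubalgebra :=
  (innerSL ℂ ζ ∘L ContinuousLinearMap.apply ℂ K θ) ∘L (vNOS M).toContinuousLinearMap

@[simp]
theorem vectorFunctional_apply (ζ θ : K) (x : M.toStarSubalgebra) :
    vectorFunctional M ζ θ x = ⟪ζ, (x : K →L[ℂ] K) θ⟫_ℂ := rfl

theorem norm_vectorFunctional_le (ζ θ : K) : ‖vectorFunctional M ζ θ‖ ≤ ‖ζ‖ * ‖θ‖ := by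
  refine ContinuousLinearMap.opNorm_le_bound _ (by positivity) fun x => ?_
  rw [vectorFunctional_apply]
  calc _ ≤ ‖ζ‖ * ‖(x : K →L[ℂ] K) θ‖ := norm_inner_le_norm _ _
    _ ≤ ‖ζ‖ * (‖(x : K →L[ℂ] K)‖ * ‖θ‖) := by gcongr; exact ContinuousLinearMap.le_opNorm _ _
    _ = ‖ζ‖ * ‖θ‖ * ‖x‖ := by rw [show ‖x‖ = ‖(x : K →L[ℂ] K)‖ from rfl]; ring

/-- A linear functional `y` on a space of functionals of `M` which is bounded on the vector
functionals is given there by the evaluation at an element of `M`: the operator of the sesquilinear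
form `(ζ, θ) ↦ y ⟪ζ, · θ⟫` commutes with the commutant of `M`. -/
theorem exists_forall_vectorFunctional_eq (P : Submodule ℂ (StrongDual ℂ M.toStarSubalgebra))
    (hP : ∀ ζ θ, vectorFunctional M ζ θ ∈ P) (y : P →ₗ[ℂ] ℂ) {C : ℝ} (hC : 0 ≤ C)
    (hy : ∀ ζ θ, ‖y ⟨vectorFunctional M ζ θ, hP ζ θ⟩‖ ≤ C * ‖ζ‖ * ‖θ‖) :
    ∃ x : M.toStarSubalgebra, ‖x‖ ≤ C ∧
      ∀ ζ θ, y ⟨vectorFunctional M ζ θ, hP ζ θ⟩ = ⟪ζ, (x : K →L[ℂ] K) θ⟫_ℂ := by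
  have hadd : ∀ (p q r : P), (r : StrongDual ℂ M.toStarSubalgebra) = p + q → y r = y p + y q := by
    intro p q r h
    rw [← map_add]
    exact congrArg y (Subtype.ext h)
  have hsmul : ∀ (c : ℂ) (p r : P), (r : StrongDual ℂ M.toStarSubalgebra) = c • p →
      y r = c * y p := by
    intro c p r h
    rw [← smul_eq_mul, ← map_smul]
    exact congrArg y (Subtype.ext h)
  obtain ⟨T, hTC, hT⟩ := exists_clm_forall_inner_eq
    (fun ζ θ => y ⟨vectorFunctional M ζ θ, hP ζ θ⟩)
    (fun ζ ζ' θ => hadd _ _ _ (by ext x; simp))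
    (fun c ζ θ => hsmul _ _ _ (by ext x; simp [mul_comm]))
    (fun ζ θ θ' => hadd _ _ _ (by ext x; simp)) (fun c ζ θ => hsmul _ _ _ (by ext x; simp)) hC hy
  -- `a` commutes with `M`, so `⟪ζ, · (a θ)⟫` and `⟪a† ζ, · θ⟫` are the same functional on `M`
  have hTM : T ∈ M := by
    rw [← VonNeumannAlgebra.commutant_commutant M, VonNeumannAlgebra.mem_commutant_iff]
    intro a ha
    rw [VonNeumannAlgebra.mem_commutant_iff] at ha
    ext θ
    refine ext_inner_left ℂ fun ζ => ?_
    rw [mul_apply_eq_comp, mul_apply_eq_comp, hT,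
      ← ContinuousLinearMap.adjoint_inner_left, hT]
    refine congrArg y (Subtype.ext ?_)
    ext x
    have hx : (x : K →L[ℂ] K) * a = a * x := ha x x.2
    simp only [vectorFunctional_apply]
    rw [ContinuousLinearMap.adjoint_inner_left, ← mul_apply_eq_comp, ← hx,
      mul_apply_eq_comp]
  exact ⟨⟨T, hTM⟩, hTC, fun ζ θ => (hT ζ θ).symm⟩

/-- The predual of `M`: the norm closed span of the vector functionals in the dual of `M`. -/
noncomputable def predual : Submodule ℂ (StrongDual ℂ M.toStarSubalgebra) :=
  (Submodule.span ℂ (Set.range fun p : K × K => vectorFunctional M p.1 p.2)).topologicalClosure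

theorem isClosed_predual : IsClosed (predual M : Set (StrongDual ℂ M.toStarSubalgebra)) :=
  Submodule.isClosed_topologicalClosure _

theorem vectorFunctional_mem_predual (ζ θ : K) : vectorFunctional M ζ θ ∈ predual M :=
  Submodule.le_topologicalClosure _ (Submodule.subset_span ⟨(ζ, θ), rfl⟩)

/-- `M` is the dual space of its predual. -/
theorem isPredual_predual : IsPredual (predual M) where
  exists_eval_eq y C hC hy := by
    obtain ⟨x, hx, h⟩ := exists_forall_vectorFunctional_eq M (predual M)
      (vectorFunctional_mem_predual M) y hC (fun ζ θ => by
        rw [mul_assoc]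
        refine (hy _).trans ?_
        gcongr
        exact norm_vectorFunctional_le M ζ θ)
    refine ⟨x, hx, fun φ => ?_⟩
    refine eq_of_eqOn_span_of_bound _ y (ContinuousLinearMap.apply ℂ ℂ x) hy ?_ φ
    rintro _ ⟨p, rfl⟩
    exact h p.1 p.2
  eq_zero_of_forall x h := by
    refine Subtype.ext (ContinuousLinearMap.ext fun θ => ext_inner_left ℂ fun ζ => ?_)
    simpa using h _ (vectorFunctional_mem_predual M ζ θ)

end Predual

/-! ### Ultraweak continuity of the elements of the predual -/

section UltraweakFunctionals

/-- An absolutely convergent series of multiples of vector functionals `T ↦ ⟪ζ i, T (θ i)⟫`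
is given by two square summable sequences. -/
theorem exists_lp_forall_tsum_inner_eq {K ι : Type*} [NormedAddCommGroup K] [InnerProductSpace ℂ K]
    (c : ι → ℂ) (hc : Summable fun i => ‖c i‖) (ζ θ : ι → K) (hζ : ∀ i, ‖ζ i‖ ≤ 1)
    (hθ : ∀ i, ‖θ i‖ ≤ 1) :
    ∃ ξ η : lp (fun _ : ℕ => K) 2, ∀ T : K →L[ℂ] K,
      ∑' k, ⟪ξ k, T (η k)⟫_ℂ = ∑' i, c i * ⟪ζ i, T (θ i)⟫_ℂ := by
  have hs : (Function.support c).Countable := by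
    have h := hc.countable_support
    rwa [show (Function.support fun i => ‖c i‖) = Function.support c by ext; simp] at h
  have : Countable (Function.support c) := hs
  obtain ⟨e, he⟩ := Countable.exists_injective_nat (Function.support c)
  -- the modulus of `c i` is shared between the two vectors
  let ξ₀ : Function.support c → K := fun i => ((√‖c i‖ : ℝ) : ℂ) • ζ i
  let η₀ : Function.support c → K := fun i => (c i / ((√‖c i‖ : ℝ) : ℂ)) • θ i
  have hpos : ∀ i : Function.support c, 0 < √‖c i‖ := fun i =>
    Real.sqrt_pos.2 (norm_pos_iff.2 i.2)
  have hξ₀ : ∀ i, ‖ξ₀ i‖ ≤ √‖c i‖ := fun i => by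
    simp only [ξ₀, norm_smul, Complex.norm_real, Real.norm_eq_abs,
      abs_of_nonneg (Real.sqrt_nonneg _)]
    exact mul_le_of_le_one_right (Real.sqrt_nonneg _) (hζ i)
  have hη₀ : ∀ i, ‖η₀ i‖ ≤ √‖c i‖ := fun i => by
    simp only [η₀, norm_smul, norm_div, Complex.norm_real, Real.norm_eq_abs,
      abs_of_nonneg (Real.sqrt_nonneg _), Real.div_sqrt]
    exact mul_le_of_le_one_right (Real.sqrt_nonneg _) (hθ i)
  have hmem : ∀ a : Function.support c → K, (∀ i, ‖a i‖ ≤ √‖c i‖) →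
      Memℓp (Function.extend e a 0) (2 : ENNReal) := fun a ha => by
    refine memℓp_gen ?_
    have h1 : (fun k => ‖Function.extend e a 0 k‖ ^ (2 : ENNReal).toReal) =
        Function.extend e (fun i => ‖a i‖ ^ 2) 0 := by
      ext k
      by_cases hk : ∃ i, e i = k
      · obtain ⟨i, rfl⟩ := hk
        simp [he.extend_apply]
      · simp [Function.extend_apply' _ _ _ hk]
    rw [h1]
    refine (summable_extend_zero he).2 (Summable.of_nonneg_of_le (fun i => by positivity)
      (fun i => ?_) (hc.comp_injective Subtype.val_injective))
    calc ‖a i‖ ^ 2 ≤ √‖c i‖ ^ 2 := by gcongr; exact ha i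
      _ = ‖c i‖ := Real.sq_sqrt (norm_nonneg _)
  refine ⟨⟨_, hmem ξ₀ hξ₀⟩, ⟨_, hmem η₀ hη₀⟩, fun T => ?_⟩
  have h1 : (fun k => ⟪Function.extend e ξ₀ 0 k, T (Function.extend e η₀ 0 k)⟫_ℂ) =
      Function.extend e (fun i => c i * ⟪ζ i, T (θ i)⟫_ℂ) 0 := by
    ext k
    by_cases hk : ∃ i, e i = k
    · obtain ⟨i, rfl⟩ := hk
      have h2 : ((√‖c i‖ : ℝ) : ℂ) ≠ 0 := Complex.ofReal_ne_zero.2 (hpos i).ne'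
      simp only [he.extend_apply, ξ₀, η₀, map_smul, inner_smul_left, inner_smul_right,
        Complex.conj_ofReal]
      field_simp
    · simp [Function.extend_apply' _ _ _ hk]
  calc _ = ∑' k, Function.extend e (fun i => c i * ⟪ζ i, T (θ i)⟫_ℂ) 0 k := by
        rw [← h1]
    _ = ∑' i : Function.support c, c i * ⟪ζ i, T (θ i)⟫_ℂ := tsum_extend_zero he _
    _ = _ := tsum_subtype_eq_of_support_subset (f := fun i => c i * ⟪ζ i, T (θ i)⟫_ℂ)
      (fun i hi => left_ne_zero_of_mul hi)

variable {K : Type*} [NormedAddCommGroup K] [InnerProductSpace ℂ K] [CompleteSpace K]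
  (M : VonNeumannAlgebra K)

/-- The map `c ↦ ∑ i, c i • ⟪ζ i, · θ i⟫` from `ℓ¹`, over the pairs `i = (ζ i, θ i)` of vectors of
norm at most one, to the dual of `M`. -/
noncomputable def vectorSeries :
    lp (fun _ : Metric.closedBall (0 : K) 1 × Metric.closedBall (0 : K) 1 => ℂ) 1 →L[ℂ]
      StrongDual ℂ M.toStarSubalgebra :=
  lp.tsumCLM ℂ _ _ ∘L lp.mapCLM 1
    (fun i => ContinuousLinearMap.toSpanSingleton ℂ (vectorFunctional M i.1 i.2)) zero_le_one
    (fun i => by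
      rw [ContinuousLinearMap.norm_toSpanSingleton]
      exact (norm_vectorFunctional_le M _ _).trans (mul_le_one₀ (mem_closedBall_zero_iff.1 i.1.2)
        (norm_nonneg _) (mem_closedBall_zero_iff.1 i.2.2)))

theorem summable_norm_of_lp_one {ι : Type*} (c : lp (fun _ : ι => ℂ) 1) :
    Summable fun i => ‖c i‖ := by
  simpa using c.2.summable (by simp)

theorem vectorSeries_apply_apply
    (c : lp (fun _ : Metric.closedBall (0 : K) 1 × Metric.closedBall (0 : K) 1 => ℂ) 1)
    (x : M.toStarSubalgebra) :
    vectorSeries M c x =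
      ∑' i, c i * ⟪(i.1 : K), (x : K →L[ℂ] K) (i.2 : K)⟫_ℂ := by
  have hs : Summable fun i : Metric.closedBall (0 : K) 1 × Metric.closedBall (0 : K) 1 =>
      c i • vectorFunctional M i.1 i.2 := by
    refine Summable.of_norm_bounded (summable_norm_of_lp_one c) fun i => ?_
    rw [norm_smul]
    exact mul_le_of_le_one_right (norm_nonneg _) ((norm_vectorFunctional_le M _ _).trans
      (mul_le_one₀ (mem_closedBall_zero_iff.1 i.1.2) (norm_nonneg _)
        (mem_closedBall_zero_iff.1 i.2.2)))
  have h1 : vectorSeries M c = ∑' i, c i • vectorFunctional M i.1 i.2 := rfl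
  rw [h1]
  exact (ContinuousLinearMap.apply ℂ ℂ x).map_tsum hs

open scoped Classical in
theorem vectorSeries_single (i : Metric.closedBall (0 : K) 1 × Metric.closedBall (0 : K) 1)
    (a : ℂ) : vectorSeries M (lp.single 1 i a) = a • vectorFunctional M i.1 i.2 := by
  ext x
  rw [vectorSeries_apply_apply, tsum_eq_single i (fun j hj => by
    rw [lp.single_apply_ne _ _ _ hj, zero_mul]), lp.single_apply_self]
  rfl

open scoped Classical in
theorem exists_vectorSeries_eq_vectorFunctional (ζ θ : K) :
    ∃ (i : _) (a : ℂ), ‖a‖ = ‖ζ‖ * ‖θ‖ ∧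
      vectorSeries M (lp.single 1 i a) = vectorFunctional M ζ θ := by
  have hn : ∀ ζ : K, ∃ ζ' : Metric.closedBall (0 : K) 1, ζ = (‖ζ‖ : ℂ) • (ζ' : K) := fun ζ => by
    refine ⟨⟨((‖ζ‖⁻¹ : ℝ) : ℂ) • ζ, ?_⟩, ?_⟩
    · rw [mem_closedBall_zero_iff, norm_smul, Complex.norm_real, norm_inv, norm_norm]
      exact inv_mul_le_one
    · rcases eq_or_ne ζ 0 with rfl | h
      · simp
      · rw [smul_smul, ← Complex.ofReal_mul, mul_inv_cancel₀ (norm_ne_zero_iff.2 h),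
          Complex.ofReal_one, one_smul]
  obtain ⟨ζ', hζ'⟩ := hn ζ
  obtain ⟨θ', hθ'⟩ := hn θ
  refine ⟨(ζ', θ'), (‖ζ‖ : ℂ) * ‖θ‖, by simp, ?_⟩
  rw [vectorSeries_single]
  ext x
  conv_rhs => rw [hζ', hθ']
  simp
  ring

/-- The space of functionals that are sums of series of vector functionals is closed: it is the
quotient of `ℓ¹` by the kernel of `vectorSeries`, because each functional on this quotient is
an element of `M`. -/
theorem isClosed_range_vectorSeries : IsClosed (Set.range (vectorSeries M)) := by
  classical
  refine isClosed_range_of_forall_dual _ fun l hl hker g => ?_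
  let P := LinearMap.range (vectorSeries M).toLinearMap
  let L := (LinearMap.ker (vectorSeries M).toLinearMap).liftQ l.toLinearMap
    (fun g hg => hker g hg)
  -- the functional `l` factors through the range of `vectorSeries M`
  let y : P →ₗ[ℂ] ℂ := L ∘ₗ (vectorSeries M).toLinearMap.quotKerEquivRange.symm.toLinearMap
  have hy : ∀ (g) (φ : P), vectorSeries M g = φ → y φ = l g := by
    rintro g ⟨φ, hφ⟩ rfl
    exact congrArg L (LinearMap.quotKerEquivRange_symm_apply_image
      (vectorSeries M).toLinearMap g hφ)
  have hP : ∀ ζ θ, vectorFunctional M ζ θ ∈ P := fun ζ θ => by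
    obtain ⟨i, a, -, h⟩ := exists_vectorSeries_eq_vectorFunctional M ζ θ
    exact ⟨_, h⟩
  obtain ⟨x, hx, hxy⟩ := exists_forall_vectorFunctional_eq M P hP y zero_le_one (fun ζ θ => by
    obtain ⟨i, a, ha, h⟩ := exists_vectorSeries_eq_vectorFunctional M ζ θ
    rw [hy _ ⟨_, hP ζ θ⟩ h, one_mul, ← ha]
    refine (l.le_of_opNorm_le hl _).trans ?_
    rw [one_mul, lp.norm_single (by norm_num)])
  have hlx : l = ContinuousLinearMap.apply ℂ ℂ x ∘L vectorSeries M := by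
    refine lp.ext_continuousLinearMap ENNReal.one_ne_top fun i => ?_
    ext
    have h1 := hxy i.1 i.2
    rw [hy (lp.single 1 i 1) _ (by rw [vectorSeries_single, one_smul])] at h1
    simpa [vectorSeries_single] using h1
  calc ‖l g‖ = ‖vectorSeries M g x‖ := by rw [hlx]; rfl
    _ ≤ ‖vectorSeries M g‖ * ‖x‖ := ContinuousLinearMap.le_opNorm _ _
    _ ≤ ‖vectorSeries M g‖ := mul_le_of_le_one_right (norm_nonneg _) hx

/-- Every element of the predual is ultraweakly continuous. -/
theorem exists_lp_of_mem_predual {φ : StrongDual ℂ M.toStarSubalgebra} (hφ : φ ∈ predual M) :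
    ∃ ξ η : lp (fun _ : ℕ => K) 2, ∀ x : M.toStarSubalgebra,
      φ x = ∑' k, ⟪ξ k, (x : K →L[ℂ] K) (η k)⟫_ℂ := by
  have hle : predual M ≤ LinearMap.range (vectorSeries M).toLinearMap := by
    refine Submodule.topologicalClosure_minimal _ (Submodule.span_le.2 ?_)
      (isClosed_range_vectorSeries M)
    rintro _ ⟨p, rfl⟩
    obtain ⟨i, a, -, h⟩ := exists_vectorSeries_eq_vectorFunctional M p.1 p.2
    exact ⟨_, h⟩
  obtain ⟨c, rfl⟩ := hle hφ
  obtain ⟨ξ, η, h⟩ := exists_lp_forall_tsum_inner_eq c (summable_norm_of_lp_one c)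
    (fun i => (i.1 : K)) (fun i => (i.2 : K)) (fun i => mem_closedBall_zero_iff.1 i.1.2)
    (fun i => mem_closedBall_zero_iff.1 i.2.2)
  exact ⟨ξ, η, fun x => (vectorSeries_apply_apply M c x).trans (h x).symm⟩

end UltraweakFunctionals

/-! ### Local reflexivity -/

section LocalReflexivity

/-- The norm of a functional on a finite `ℓ^∞`-sum is at least the `ℓ¹`-norm of its components. -/
theorem sum_norm_comp_single_le {ι E : Type*} [Fintype ι] [DecidableEq ι] [NormedAddCommGroup E]
    [NormedSpace ℂ E] (y : StrongDual ℂ (ι → E)) :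
    ∑ j, ‖y ∘L ContinuousLinearMap.single ℂ (fun _ : ι => E) j‖ ≤ ‖y‖ := by
  have h1 : ∀ φ : ι → E, (∀ j, ‖φ j‖ ≤ 1) →
      ∑ j, ‖(y ∘L ContinuousLinearMap.single ℂ (fun _ : ι => E) j) (φ j)‖ ≤ ‖y‖ := by
    intro φ hφ
    -- phases that make all terms nonnegative
    choose c hc hcy using fun j => RCLike.exists_norm_eq_mul_self
      ((y ∘L ContinuousLinearMap.single ℂ (fun _ : ι => E) j) (φ j))
    have h2 : ((∑ j, ‖(y ∘L ContinuousLinearMap.single ℂ (fun _ : ι => E) j) (φ j)‖ : ℝ) : ℂ) =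
        y (fun j => c j • φ j) := by
      push_cast
      rw [← LinearMap.sum_single_apply (φ := fun _ : ι => E) (fun j => c j • φ j), map_sum]
      refine Finset.sum_congr rfl fun j _ => (hcy j).trans ?_
      rw [← smul_eq_mul, ← map_smul]
      rfl
    have h3 : ‖(fun j => c j • φ j)‖ ≤ 1 := (pi_norm_le_iff_of_nonneg zero_le_one).2 fun j => by
      rw [norm_smul, hc, one_mul]
      exact hφ j
    calc _ = ‖((∑ j, ‖(y ∘L ContinuousLinearMap.single ℂ (fun _ : ι => E) j) (φ j)‖ : ℝ) : ℂ)‖ := by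
          rw [Complex.norm_real, Real.norm_of_nonneg (by positivity)]
      _ ≤ ‖y‖ * 1 := by
          rw [h2]
          exact (y.le_opNorm _).trans (by gcongr)
      _ = ‖y‖ := mul_one _
  refine le_of_forall_pos_le_add fun ε hε => ?_
  have hδ : 0 < ε / (Fintype.card ι + 1) := by positivity
  choose φ hφ hφy using fun j => ContinuousLinearMap.exists_lt_apply_of_lt_opNorm
    (y ∘L ContinuousLinearMap.single ℂ (fun _ : ι => E) j) (sub_lt_self _ hδ)
  calc _ ≤ ∑ j, (‖(y ∘L ContinuousLinearMap.single ℂ (fun _ : ι => E) j) (φ j)‖ +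
        ε / (Fintype.card ι + 1)) :=
        Finset.sum_le_sum fun j _ => by linarith [hφy j]
    _ = ∑ j, ‖(y ∘L ContinuousLinearMap.single ℂ (fun _ : ι => E) j) (φ j)‖ +
        Fintype.card ι * (ε / (Fintype.card ι + 1)) := by
        rw [Finset.sum_add_distrib, Finset.sum_const, nsmul_eq_mul]; rfl
    _ ≤ ‖y‖ + ε := by
        refine add_le_add (h1 φ fun j => (hφ j).le) ?_
        rw [← mul_div_assoc, div_le_iff₀ (by positivity)]
        nlinarith

/-- Up to a factor `1 + ε`, finitely many functionals of norm at most one determine the norm of a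
finite-dimensional space. -/
theorem exists_finset_dual_norming (F : Type*) [NormedAddCommGroup F] [NormedSpace ℂ F]
    [FiniteDimensional ℂ F] {ε : ℝ} (hε : 0 < ε) :
    ∃ t : Finset (StrongDual ℂ F), (∀ g ∈ t, ‖g‖ ≤ 1) ∧
      ∀ a C, 0 ≤ C → (∀ g ∈ t, ‖g a‖ ≤ C) → ‖a‖ ≤ (1 + ε) * C := by
  have : ProperSpace (StrongDual ℂ F) := FiniteDimensional.proper ℂ _
  have hδ : 0 < ε / (1 + ε) := by positivity
  obtain ⟨t, ht, htf, hcov⟩ :=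
    (isCompact_closedBall (0 : StrongDual ℂ F) 1).finite_cover_balls hδ
  refine ⟨htf.toFinset, fun g hg => ?_, fun a C hC h => ?_⟩
  · simpa using ht ((Set.Finite.mem_toFinset _).1 hg)
  · obtain ⟨g, hg, hga⟩ := exists_dual_vector'' ℂ a
    obtain ⟨g', hg', hgg'⟩ := Set.mem_iUnion₂.1 (hcov (mem_closedBall_zero_iff.2 hg))
    have h1 : ‖g - g'‖ ≤ ε / (1 + ε) := by
      rw [← dist_eq_norm]; exact (Metric.mem_ball.1 hgg').le
    have h2 : ‖a‖ ≤ ε / (1 + ε) * ‖a‖ + C := by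
      calc ‖a‖ = ‖(g - g') a + g' a‖ := by simp [hga]
        _ ≤ ‖(g - g') a‖ + ‖g' a‖ := norm_add_le _ _
        _ ≤ _ := add_le_add ((g - g').le_of_opNorm_le h1 a)
          (h g' ((Set.Finite.mem_toFinset _).2 hg'))
    have h3 : (1 + ε) * ‖a‖ ≤ (1 + ε) * (ε / (1 + ε) * ‖a‖ + C) := by gcongr
    have h4 : (1 + ε) * (ε / (1 + ε) * ‖a‖ + C) = ε * ‖a‖ + (1 + ε) * C := by field_simp
    linarith

/-- The number `∑ f i (u (x i))` depends only on the tensor `∑ f i ⊗ x i`, regarded as the map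
`a ↦ ∑ f i a • x i` from `F` to `X`. -/
theorem sum_apply_apply_eq_sum_coord {ι κ X F : Type*} [Fintype ι] [Fintype κ]
    [NormedAddCommGroup X] [NormedSpace ℂ X] [NormedAddCommGroup F] [NormedSpace ℂ F]
    (b : Module.Basis κ ℂ F) (u : X →L[ℂ] F) (f : ι → StrongDual ℂ F) (x : ι → X) :
    ∑ i, f i (u (x i)) = ∑ k, b.coord k (u (∑ i, f i (b k) • x i)) := by
  have h1 : ∀ i, f i (u (x i)) = ∑ k, f i (b k) * b.coord k (u (x i)) := fun i => by
    conv_lhs => rw [← b.sum_repr (u (x i)), map_sum]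
    refine Finset.sum_congr rfl fun k _ => ?_
    rw [map_smul, smul_eq_mul, mul_comm]
    rfl
  simp only [h1, map_sum, map_smul, smul_eq_mul]
  exact Finset.sum_comm

variable {X F : Type*} [NormedAddCommGroup X] [NormedSpace ℂ X] [NormedAddCommGroup F]
  [NormedSpace ℂ F]

/-- The operators `w : X → F` that are continuous for the weak topology given by `P`, in the sense
that `f ∘ w ∈ P` for all functionals `f` on `F`. -/
def coordSubmodule (P : Submodule ℂ (StrongDual ℂ X)) (F : Type*) [NormedAddCommGroup F]
    [NormedSpace ℂ F] : Submodule ℂ (X →L[ℂ] F) where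
  carrier := {w | ∀ f : StrongDual ℂ F, f ∘L w ∈ P}
  add_mem' hw hw' f := by
    rw [ContinuousLinearMap.comp_add]
    exact P.add_mem (hw f) (hw' f)
  zero_mem' f := by
    rw [ContinuousLinearMap.comp_zero]
    exact P.zero_mem
  smul_mem' c w hw f := by
    rw [ContinuousLinearMap.comp_smul]
    exact P.smul_mem c (hw f)

/-- If `X` is the dual of `P`, then a functional of the form `w ↦ ∑ f i (w (x i))` on the operators
`X → F` that is at most `s‖·‖` on the finite rank operators with coefficients in `P` can be
written with other `f` and `x` so that `∑ ‖f i‖ ‖x i‖ ≤ (1 + ε) s`. The functionals `f` are taken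
from a finite norming set, which embeds the space of these operators into a finite power of `P`. -/
theorem exists_sum_smul_eq_of_forall_norm_sum_le [FiniteDimensional ℂ F]
    {P : Submodule ℂ (StrongDual ℂ X)} (hP : IsPredual P)
    {ι : Type*} [Fintype ι] (x : ι → X) (f : ι → StrongDual ℂ F) {s ε : ℝ} (hs : 0 ≤ s)
    (hε : 0 < ε) (h : ∀ w ∈ coordSubmodule P F, ‖∑ i, f i (w (x i))‖ ≤ s * ‖w‖) :
    ∃ (t : Finset (StrongDual ℂ F)) (x' : t → X), (∀ g ∈ t, ‖g‖ ≤ 1) ∧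
      ∑ j, ‖x' j‖ ≤ (1 + ε) * s ∧ ∀ a : F, ∑ i, f i a • x i = ∑ j : t, j.1 a • x' j := by
  classical
  obtain ⟨t, ht1, ht⟩ := exists_finset_dual_norming F hε
  let W := coordSubmodule P F
  -- the norming set embeds `W` into a finite power of the dual of `X`
  let T : W →ₗ[ℂ] (t → StrongDual ℂ X) :=
    { toFun := fun w j => j.1 ∘L w.1
      map_add' := fun w w' => by
        ext j : 1
        exact ContinuousLinearMap.comp_add _ _ _
      map_smul' := fun c w => by
        ext j : 1
        exact ContinuousLinearMap.comp_smul _ _ _ }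
  have hT : ∀ w : W, ‖w.1‖ ≤ (1 + ε) * ‖T w‖ := fun w => by
    refine w.1.opNorm_le_bound (by positivity) fun z => ?_
    rw [mul_assoc]
    refine ht _ _ (by positivity) fun g hg => ?_
    calc ‖g (w.1 z)‖ = ‖(g ∘L w.1) z‖ := rfl
      _ ≤ ‖g ∘L w.1‖ * ‖z‖ := ContinuousLinearMap.le_opNorm _ _
      _ ≤ ‖T w‖ * ‖z‖ := by
        gcongr
        exact norm_le_pi_norm (T w) ⟨g, hg⟩
  have hinj : Function.Injective T := (injective_iff_map_eq_zero T).2 fun w hw => by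
    have h1 := hT w
    rw [hw, norm_zero, mul_zero] at h1
    exact Subtype.ext (norm_le_zero_iff.1 h1)
  let Ψ : W →ₗ[ℂ] ℂ :=
    { toFun := fun w => ∑ i, f i (w.1 (x i))
      map_add' := fun w w' => by
        simp [Finset.sum_add_distrib]
      map_smul' := fun c w => by
        simp [Finset.mul_sum] }
  let e := LinearEquiv.ofInjective T hinj
  obtain ⟨y, hyψ, hy⟩ := Module.Dual.exists_continuous_extension_of_le_seminorm
    (LinearMap.range T) (Ψ ∘ₗ e.symm.toLinearMap)
    (p := ((1 + ε) * s).toNNReal • normSeminorm ℂ (t → StrongDual ℂ X))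
    (continuous_norm.const_smul ((1 + ε) * s).toNNReal) (fun p => by
      obtain ⟨w, rfl⟩ := e.surjective p
      rw [LinearMap.comp_apply, LinearEquiv.coe_coe, e.symm_apply_apply]
      change ‖Ψ w‖ ≤ ((1 + ε) * s).toNNReal * ‖T w‖
      rw [Real.coe_toNNReal _ (by positivity)]
      calc ‖Ψ w‖ ≤ s * ‖w.1‖ := h w.1 w.2
        _ ≤ s * ((1 + ε) * ‖T w‖) := by gcongr; exact hT w
        _ = (1 + ε) * s * ‖T w‖ := by ring)
  have hyn : ‖y‖ ≤ (1 + ε) * s := y.opNorm_le_bound (by positivity) fun z => by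
    have h1 : ‖y z‖ ≤ ((1 + ε) * s).toNNReal * ‖z‖ := hy z
    rwa [Real.coe_toNNReal _ (by positivity)] at h1
  have hyT : ∀ w : W, y (T w) = Ψ w := fun w => by
    refine (hyψ (e w)).trans ?_
    rw [LinearMap.comp_apply, LinearEquiv.coe_coe, e.symm_apply_apply]
  let Y : t → StrongDual ℂ (StrongDual ℂ X) :=
    fun j => y ∘L ContinuousLinearMap.single ℂ (fun _ : t => StrongDual ℂ X) j
  choose x' hx' hYx using fun j => hP.exists_eval_eq ((Y j).toLinearMap.domRestrict P)
    (C := ‖Y j‖) (Y j).opNorm_nonneg (fun φ => (Y j).le_opNorm φ)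
  refine ⟨t, x', ht1, ?_, fun a => ?_⟩
  · exact (Finset.sum_le_sum fun j _ => hx' j).trans ((sum_norm_comp_single_le y).trans hyn)
  · rw [← sub_eq_zero]
    refine hP.eq_zero_of_forall _ fun φ hφ => ?_
    -- compare the two forms of the functional on the operator `φ(·) a` of rank one
    have hw : φ.smulRight a ∈ W := fun g => by
      have : g ∘L φ.smulRight a = g a • φ := by
        ext z
        simp [mul_comm]
      rw [this]
      exact P.smul_mem _ hφ
    have h1 := hyT ⟨_, hw⟩
    have h2 : Ψ ⟨_, hw⟩ = φ (∑ i, f i a • x i) := by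
      simp only [Ψ, map_sum, map_smul]
      change ∑ i, f i (φ (x i) • a) = _
      simp [mul_comm]
    have h3 : y (T ⟨_, hw⟩) = φ (∑ j : t, j.1 a • x' j) := by
      rw [← LinearMap.sum_single_apply (φ := fun _ : t => StrongDual ℂ X) (T ⟨_, hw⟩), map_sum,
        map_sum]
      refine Finset.sum_congr rfl fun j _ => ?_
      have h4 : T ⟨_, hw⟩ j = j.1 a • φ := by
        ext z
        simp [T, mul_comm]
      have h5 : Y j φ = φ (x' j) := hYx j ⟨φ, hφ⟩
      rw [map_smul, h4, ← h5, ← map_smul]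
      rfl
    rw [map_sub, sub_eq_zero, ← h2, ← h3, h1]

/-- Multiplying by phases and scaling turn a bound on the real part over the unit ball into a bound
on the absolute value. -/
theorem norm_sum_le_mul_norm_of_forall_re_le (W : Submodule ℂ (X →L[ℂ] F)) {ι : Type*} [Fintype ι]
    (x : ι → X) (f : ι → StrongDual ℂ F) {s : ℝ}
    (h : ∀ w ∈ W, ‖w‖ ≤ 1 → RCLike.re (∑ i, f i (w (x i))) ≤ s) {w : X →L[ℂ] F} (hw : w ∈ W) :
    ‖∑ i, f i (w (x i))‖ ≤ s * ‖w‖ := by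
  rcases eq_or_ne w 0 with rfl | hw0
  · simp
  obtain ⟨b, hb, hbw⟩ := RCLike.exists_norm_eq_mul_self (∑ i, f i (w (x i)))
  have hw1 : 0 < ‖w‖ := norm_pos_iff.2 hw0
  have h1 := h ((b * (‖w‖⁻¹ : ℝ)) • w) (W.smul_mem _ hw) (by
    rw [norm_smul, norm_mul, hb, Complex.norm_real, norm_inv, norm_norm, one_mul,
      inv_mul_cancel₀ hw1.ne'])
  have h2 : ∑ i, f i (((b * (‖w‖⁻¹ : ℝ)) • w) (x i)) =
      ((‖w‖⁻¹ * ‖∑ i, f i (w (x i))‖ : ℝ) : ℂ) := by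
    simp only [smul_apply, map_smul, smul_eq_mul]
    rw [← Finset.mul_sum, Complex.ofReal_mul]
    refine Eq.trans ?_ (congrArg _ hbw.symm)
    ring
  rw [h2] at h1
  have h3 : ‖w‖⁻¹ * ‖∑ i, f i (w (x i))‖ ≤ s := h1
  rw [inv_mul_le_iff₀ hw1] at h3
  linarith

/-- A form of the principle of local reflexivity: if `X` is the dual of `P`, then any contraction
`u` from `X` to a finite-dimensional space obeys the linear inequalities that hold for all
contractions with coefficients in `P`. -/
theorem re_sum_apply_le_of_forall_coordSubmodule [FiniteDimensional ℂ F]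
    {P : Submodule ℂ (StrongDual ℂ X)} (hP : IsPredual P)
    {ι : Type*} [Fintype ι] (x : ι → X) (f : ι → StrongDual ℂ F) {s : ℝ}
    (h : ∀ w ∈ coordSubmodule P F, ‖w‖ ≤ 1 → RCLike.re (∑ i, f i (w (x i))) ≤ s)
    {u : X →L[ℂ] F} (hu : ‖u‖ ≤ 1) : RCLike.re (∑ i, f i (u (x i))) ≤ s := by
  have hs : 0 ≤ s := by simpa using h 0 (Submodule.zero_mem _) (by simp)
  have h1 : ∀ ε : ℝ, 0 < ε → ‖∑ i, f i (u (x i))‖ ≤ (1 + ε) * s := fun ε hε => by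
    obtain ⟨t, x', ht, hx', heq⟩ :=
      exists_sum_smul_eq_of_forall_norm_sum_le hP x f hs hε
        fun w hw => norm_sum_le_mul_norm_of_forall_re_le _ x f h hw
    have h2 : ∑ i, f i (u (x i)) = ∑ j : t, j.1 (u (x' j)) := by
      rw [sum_apply_apply_eq_sum_coord (Module.finBasis ℂ F),
        sum_apply_apply_eq_sum_coord (Module.finBasis ℂ F)]
      simp only [heq]
    rw [h2]
    refine (norm_sum_le_of_le _ fun j _ => ?_).trans hx'
    calc ‖j.1 (u (x' j))‖ ≤ 1 * (1 * ‖x' j‖) :=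
          (j.1.le_of_opNorm_le (ht j.1 j.2) _).trans (by gcongr; exact u.le_of_opNorm_le hu _)
      _ = ‖x' j‖ := by ring
  refine (RCLike.re_le_norm _).trans (le_of_forall_pos_le_add fun δ hδ => ?_)
  refine (h1 (δ / (s + 1)) (by positivity)).trans ?_
  have : δ / (s + 1) * s ≤ δ := by
    rw [div_mul_eq_mul_div, div_le_iff₀ (by positivity)]
    nlinarith
  linarith

end LocalReflexivity

/-! ### Approximation by maps with coefficients in the predual -/

section WeakApproximation

/-- A continuous functional on a product `I → ℂ` depends on finitely many coordinates. -/
theorem exists_finset_forall_eq_sum {I : Type*} (f : StrongDual ℂ (I → ℂ)) :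
    ∃ (t : Finset I) (c : I → ℂ), ∀ g : I → ℂ, f g = ∑ i ∈ t, c i * g i := by
  classical
  have hU : f ⁻¹' Metric.ball 0 1 ∈ 𝓝 (0 : I → ℂ) :=
    f.continuous.continuousAt.preimage_mem_nhds (by
      rw [map_zero]; exact Metric.ball_mem_nhds _ zero_lt_one)
  rw [nhds_pi, Filter.mem_pi] at hU
  obtain ⟨t, ht, V, hV, hsub⟩ := hU
  -- a function that vanishes on `t` stays in the neighbourhood when it is scaled
  have h0 : ∀ g : I → ℂ, (∀ i ∈ t, g i = 0) → f g = 0 := fun g hg => by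
    by_contra hne
    have h1 : f ((f g)⁻¹ • g) ∈ Metric.ball (0 : ℂ) 1 := hsub fun i hi => by
      rw [Pi.smul_apply, hg i hi, smul_zero]
      exact mem_of_mem_nhds (hV i)
    rw [map_smul, smul_eq_mul, inv_mul_cancel₀ hne] at h1
    simp at h1
  refine ⟨ht.toFinset, fun i => f (Pi.single i 1), fun g => ?_⟩
  have h2 := h0 (g - ∑ i ∈ ht.toFinset, g i • Pi.single i 1) fun i hi => by
    simp [Finset.sum_apply, Pi.single_apply, hi]
  rw [map_sub, sub_eq_zero, map_sum] at h2
  rw [h2]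
  exact Finset.sum_congr rfl fun i _ => by rw [map_smul, smul_eq_mul, mul_comm]

variable {X : Type*} [NormedAddCommGroup X] [NormedSpace ℂ X]
  {H : Type*} [NormedAddCommGroup H] [InnerProductSpace ℂ H]

/-- The coefficient `x ↦ ⟪ξ, w x η⟫` of an operator valued map `w`. -/
noncomputable def coeff (w : X →L[ℂ] (H →L[ℂ] H)) (ξ η : H) : StrongDual ℂ X :=
  (innerSL ℂ ξ ∘L ContinuousLinearMap.apply ℂ H η) ∘L w

@[simp]
theorem coeff_apply (w : X →L[ℂ] (H →L[ℂ] H)) (ξ η : H) (x : X) :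
    coeff w ξ η x = ⟪ξ, w x η⟫_ℂ := rfl

theorem norm_coeff_le {w : X →L[ℂ] (H →L[ℂ] H)} (hw : ‖w‖ ≤ 1) (ξ η : H) :
    ‖coeff w ξ η‖ ≤ ‖ξ‖ * ‖η‖ := by
  refine ContinuousLinearMap.opNorm_le_bound _ (by positivity) fun x => ?_
  calc ‖⟪ξ, w x η⟫_ℂ‖ ≤ ‖ξ‖ * ‖w x η‖ := norm_inner_le_norm _ _
    _ ≤ ‖ξ‖ * (1 * ‖x‖ * ‖η‖) := by
        gcongr
        exact (w x).le_of_opNorm_le (w.le_of_opNorm_le hw x) η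
    _ = ‖ξ‖ * ‖η‖ * ‖x‖ := by ring

/-- The contractions `X → B(H)` with coefficients in `P`. -/
abbrev CoeffContraction (P : Submodule ℂ (StrongDual ℂ X)) (H : Type*) [NormedAddCommGroup H]
    [InnerProductSpace ℂ H] :=
  {w : X →L[ℂ] (H →L[ℂ] H) // ‖w‖ ≤ 1 ∧ ∀ ξ η, coeff w ξ η ∈ P}

theorem convex_range_coeffContraction (P : Submodule ℂ (StrongDual ℂ X)) :
    Convex ℝ (Set.range fun (w : CoeffContraction P H) (p : X × H × H) =>
      coeff w.1 p.2.1 p.2.2 p.1) := by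
  rintro _ ⟨w, rfl⟩ _ ⟨w', rfl⟩ a b ha hb hab
  refine ⟨⟨(a : ℂ) • w.1 + (b : ℂ) • w'.1, ?_, fun ξ η => ?_⟩, ?_⟩
  · refine (norm_add_le ((a : ℂ) • w.1) ((b : ℂ) • w'.1)).trans
      ((add_le_add (ContinuousLinearMap.opNorm_smul_le (a : ℂ) w.1)
        (ContinuousLinearMap.opNorm_smul_le (b : ℂ) w'.1)).trans ?_)
    rw [Complex.norm_real, Complex.norm_real, Real.norm_of_nonneg ha, Real.norm_of_nonneg hb]
    have h1 := mul_le_mul_of_nonneg_left w.2.1 ha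
    have h2 := mul_le_mul_of_nonneg_left w'.2.1 hb
    linarith
  · have : coeff ((a : ℂ) • w.1 + (b : ℂ) • w'.1) ξ η =
        (a : ℂ) • coeff w.1 ξ η + (b : ℂ) • coeff w'.1 ξ η := by
      ext x
      simp
    rw [this]
    exact P.add_mem (P.smul_mem _ (w.2.2 ξ η)) (P.smul_mem _ (w'.2.2 ξ η))
  · ext p
    simp

variable [CompleteSpace H]

/-- The inequality of `re_sum_apply_le_of_forall_coordSubmodule` for matrix coefficients of
contractions to `B(H)`, at vectors of a finite-dimensional subspace `V E`: both `u` and the maps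
with coefficients in `P` are compared with maps to `B(E)`. -/
theorem re_sum_inner_le_of_forall_coeffContraction {P : Submodule ℂ (StrongDual ℂ X)}
    (hP : IsPredual P)
    {E : Type*} [NormedAddCommGroup E] [InnerProductSpace ℂ E] [FiniteDimensional ℂ E]
    (V : E →ₗᵢ[ℂ] H) {ι : Type*} [Fintype ι] (x : ι → X) (ξ η : ι → E) (c : ι → ℂ) {r : ℝ}
    (h : ∀ w : CoeffContraction P H,
      RCLike.re (∑ i, c i * ⟪V (ξ i), w.1 (x i) (V (η i))⟫_ℂ) ≤ r)
    {u : X →L[ℂ] (H →L[ℂ] H)} (hu : ‖u‖ ≤ 1) :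
    RCLike.re (∑ i, c i * ⟪V (ξ i), u (x i) (V (η i))⟫_ℂ) ≤ r := by
  have : CompleteSpace E := FiniteDimensional.complete ℂ E
  have hV : ‖V.toContinuousLinearMap‖ ≤ 1 := V.norm_toContinuousLinearMap_le
  have hV' : ‖ContinuousLinearMap.adjoint V.toContinuousLinearMap‖ ≤ 1 := by
    rwa [LinearIsometryEquiv.norm_map]
  have hVV : ∀ α : E, ContinuousLinearMap.adjoint V.toContinuousLinearMap (V α) = α := fun α =>
    ext_inner_left ℂ fun β =>
      (ContinuousLinearMap.adjoint_inner_right V.toContinuousLinearMap _ _).trans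
        (V.inner_map_map β α)
  let F : ι → StrongDual ℂ (E →L[ℂ] E) := fun i =>
    c i • (innerSL ℂ (ξ i) ∘L ContinuousLinearMap.apply ℂ E (η i))
  have hF : ∀ i A, F i A = c i * ⟪ξ i, A (η i)⟫_ℂ := fun _ _ => rfl
  -- a contraction to `B(E)` with coefficients in `P` is also one to `B(H)`
  have h1 : ∀ w ∈ coordSubmodule P (E →L[ℂ] E), ‖w‖ ≤ 1 →
      RCLike.re (∑ i, F i (w (x i))) ≤ r := fun w hw hw1 => by
    refine le_of_eq_of_le (congrArg _ (Finset.sum_congr rfl fun i _ => ?_))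
      (h ⟨conjCLM V.toContinuousLinearMap ∘L w, (ContinuousLinearMap.opNorm_comp_le _ _).trans
        (mul_le_one₀ (norm_conjCLM_le_one hV) (norm_nonneg w) hw1), fun ζ θ => ?_⟩)
    · rw [hF]
      congr 1
      refine Eq.symm
        ((inner_conjCLM V.toContinuousLinearMap (w (x i)) (V (ξ i)) (V (η i))).trans ?_)
      rw [hVV, hVV]
    · have : coeff (conjCLM V.toContinuousLinearMap ∘L w) ζ θ =
          (innerSL ℂ (ContinuousLinearMap.adjoint V.toContinuousLinearMap ζ) ∘L
            ContinuousLinearMap.apply ℂ E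
              (ContinuousLinearMap.adjoint V.toContinuousLinearMap θ)) ∘L w := by
        ext x
        exact inner_conjCLM V.toContinuousLinearMap (w x) ζ θ
      rw [this]
      exact hw _
  have h2 := re_sum_apply_le_of_forall_coordSubmodule hP x F h1
    (u := conjCLM (ContinuousLinearMap.adjoint V.toContinuousLinearMap) ∘L u)
    ((ContinuousLinearMap.opNorm_comp_le _ _).trans
      (mul_le_one₀ (norm_conjCLM_le_one hV') (norm_nonneg u) hu))
  refine le_of_eq_of_le (congrArg _ (Finset.sum_congr rfl fun i _ => ?_)) h2
  rw [hF]
  congr 1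
  refine Eq.symm ((inner_conjCLM _ (u (x i)) (ξ i) (η i)).trans ?_)
  rw [ContinuousLinearMap.adjoint_adjoint]
  rfl

/-- If `X` is the dual of `P`, then each contraction `u : X → B(H)` is a pointwise limit, in the
weak operator topology, of contractions with coefficients in `P`. By the Hahn-Banach theorem this
is a matter of linear inequalities, which only involve the compression of `u` to
a finite-dimensional subspace. -/
theorem mem_closure_range_coeffContraction {P : Submodule ℂ (StrongDual ℂ X)}
    (hP : IsPredual P)
    {u : X →L[ℂ] (H →L[ℂ] H)} (hu : ‖u‖ ≤ 1) :
    (fun p : X × H × H => coeff u p.2.1 p.2.2 p.1) ∈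
      closure (Set.range fun (w : CoeffContraction P H) (p : X × H × H) =>
        coeff w.1 p.2.1 p.2.2 p.1) := by
  by_contra hnot
  obtain ⟨f, r, hfr, hru⟩ := RCLike.geometric_hahn_banach_closed_point (𝕜 := ℂ)
    (convex_range_coeffContraction P).closure isClosed_closure hnot
  obtain ⟨t, c, hf⟩ := exists_finset_forall_eq_sum f
  let E : Submodule ℂ H := Submodule.span ℂ
    ((fun p : X × H × H => p.2.1) '' t ∪ (fun p : X × H × H => p.2.2) '' t)
  have : FiniteDimensional ℂ E := FiniteDimensional.span_of_finite ℂ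
    ((t.finite_toSet.image _).union (t.finite_toSet.image _))
  have h := re_sum_inner_le_of_forall_coeffContraction hP E.subtypeₗᵢ
    (fun p : t => p.1.1)
    (fun p => ⟨p.1.2.1, Submodule.subset_span (Or.inl ⟨p.1, p.2, rfl⟩)⟩)
    (fun p => ⟨p.1.2.2, Submodule.subset_span (Or.inr ⟨p.1, p.2, rfl⟩)⟩)
    (fun p => c p.1) (r := r) (fun w => by
      refine le_trans (le_of_eq ?_) (hfr _ (subset_closure ⟨w, rfl⟩)).le
      rw [hf, ← Finset.sum_coe_sort t]
      rfl) hu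
  refine absurd h (not_le.2 (hru.trans_eq ?_))
  rw [hf, ← Finset.sum_coe_sort t]
  rfl

theorem exists_ultrafilter_tendsto_coeffContraction {P : Submodule ℂ (StrongDual ℂ X)}
    (hP : IsPredual P)
    {u : X →L[ℂ] (H →L[ℂ] H)} (hu : ‖u‖ ≤ 1) :
    ∃ U : Ultrafilter (CoeffContraction P H), ∀ x ξ η,
      Tendsto (fun w : CoeffContraction P H => ⟪ξ, w.1 x η⟫_ℂ) U (𝓝 ⟪ξ, u x η⟫_ℂ) := by
  have h := mem_closure_range_coeffContraction hP hu
  let Fn := fun (w : CoeffContraction P H) (p : X × H × H) => coeff w.1 p.2.1 p.2.2 p.1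
  have hne : (comap Fn (𝓝 fun p : X × H × H => coeff u p.2.1 p.2.2 p.1)).NeBot := by
    refine comap_neBot fun t ht => ?_
    obtain ⟨_, h1, w, rfl⟩ := mem_closure_iff_nhds.1 h t ht
    exact ⟨w, h1⟩
  have hU : Tendsto Fn (Ultrafilter.of (comap Fn (𝓝 fun p : X × H × H => coeff u p.2.1 p.2.2 p.1)))
      (𝓝 fun p : X × H × H => coeff u p.2.1 p.2.2 p.1) :=
    tendsto_comap.mono_left (Ultrafilter.of_le _)
  exact ⟨_, fun x ξ η => tendsto_pi_nhds.1 hU (x, ξ, η)⟩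

end WeakApproximation

/-! ### Limits of compressions -/

section UltrafilterCompression

variable {H H' ι : Type*} [NormedAddCommGroup H] [InnerProductSpace ℂ H] [CompleteSpace H]
  [NormedAddCommGroup H'] [InnerProductSpace ℂ H'] (V : ι → H →ₗᵢ[ℂ] H') (U : Ultrafilter ι)

/-- Given isometries `V i : H → H'` and an ultrafilter on the index set, the compressions
`(V i)† T (V i)` of an operator `T` on `H'` converge in the weak operator topology, to an operator
that depends linearly on `T`. -/
theorem exists_clm_tendsto_compression :
    ∃ Ψ : (H' →L[ℂ] H') →L[ℂ] (H →L[ℂ] H),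
      ∀ T ξ η, Tendsto (fun i => ⟪V i ξ, T (V i η)⟫_ℂ) U (𝓝 ⟪ξ, Ψ T η⟫_ℂ) := by
  have hbd : ∀ (T : H' →L[ℂ] H') (ξ η : H) (i : ι),
      ‖⟪V i ξ, T (V i η)⟫_ℂ‖ ≤ ‖T‖ * ‖ξ‖ * ‖η‖ := fun T ξ η i =>
    calc _ ≤ ‖V i ξ‖ * ‖T (V i η)‖ := norm_inner_le_norm _ _
      _ ≤ ‖V i ξ‖ * (‖T‖ * ‖V i η‖) := by
          gcongr
          exact T.le_opNorm _
      _ = _ := by rw [LinearIsometry.norm_map, LinearIsometry.norm_map]; ring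
  have hlim : ∀ (T : H' →L[ℂ] H') (ξ η : H),
      ∃ z : ℂ, Tendsto (fun i => ⟪V i ξ, T (V i η)⟫_ℂ) U (𝓝 z) := fun T ξ η => by
    obtain ⟨z, -, hz⟩ := (isCompact_closedBall (0 : ℂ) (‖T‖ * ‖ξ‖ * ‖η‖)).ultrafilter_le_nhds
      (U.map fun i => ⟪V i ξ, T (V i η)⟫_ℂ)
      (le_principal_iff.2 (Filter.mem_map.2 (Filter.univ_mem' fun i =>
        mem_closedBall_zero_iff.2 (hbd T ξ η i))))
    exact ⟨z, hz⟩
  choose z hz using hlim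
  have huniq : ∀ {T ξ η} {z' : ℂ}, Tendsto (fun i => ⟪V i ξ, T (V i η)⟫_ℂ) U (𝓝 z') →
      z T ξ η = z' := fun h => tendsto_nhds_unique (hz _ _ _) h
  have hzbd : ∀ T ξ η, ‖z T ξ η‖ ≤ ‖T‖ * ‖ξ‖ * ‖η‖ := fun T ξ η =>
    le_of_tendsto (hz T ξ η).norm (Filter.Eventually.of_forall fun i => hbd T ξ η i)
  choose S hS hSz using fun T => exists_clm_forall_inner_eq (z T)
    (fun ζ ζ' θ => huniq (by
      simpa only [map_add, inner_add_left] using (hz T ζ θ).add (hz T ζ' θ)))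
    (fun c ζ θ => huniq (by
      simpa only [map_smul, inner_smul_left] using (hz T ζ θ).const_mul (starRingEnd ℂ c)))
    (fun ζ θ θ' => huniq (by
      simpa only [map_add, inner_add_right] using (hz T ζ θ).add (hz T ζ θ')))
    (fun c ζ θ => huniq (by
      simpa only [map_smul, inner_smul_right] using (hz T ζ θ).const_mul c))
    (norm_nonneg T) (hzbd T)
  refine ⟨LinearMap.mkContinuous
    { toFun := S
      map_add' := fun T T' => ContinuousLinearMap.ext fun η => ext_inner_left ℂ fun ξ => by
        rw [hSz, add_apply, inner_add_right, hSz, hSz]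
        refine huniq ?_
        simpa only [add_apply, inner_add_right] using (hz T ξ η).add (hz T' ξ η)
      map_smul' := fun c T => ContinuousLinearMap.ext fun η => ext_inner_left ℂ fun ξ => by
        rw [RingHom.id_apply, hSz, smul_apply, inner_smul_right, hSz]
        refine huniq ?_
        simpa only [smul_apply, inner_smul_right] using (hz T ξ η).const_mul c }
    1 (fun T => by rw [one_mul]; exact hS T), fun T ξ η => ?_⟩
  have := hz T ξ η
  rw [← hSz] at this
  exact this

variable {V U}

/-- A weak limit of compressions is completely contractive. -/
theorem isCompleteContraction_of_tendsto_compression {Ψ : (H' →L[ℂ] H') →L[ℂ] (H →L[ℂ] H)}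
    (hΨ : ∀ T ξ η, Tendsto (fun i => ⟪V i ξ, T (V i η)⟫_ℂ) U (𝓝 ⟪ξ, Ψ T η⟫_ℂ)) :
    IsCompleteContraction (fullOS H') (fullOS H) Ψ := by
  intro n T
  refine norm_blockOp_le (norm_nonneg (blockOp (T.map (fullOS H')))) fun ξ η => ?_
  refine le_of_tendsto (tendsto_finsetSum _ fun k _ => tendsto_finsetSum _ fun l _ =>
    hΨ (T k l) (ξ k) (η l)).norm (Filter.Eventually.of_forall fun i => ?_)
  have h := norm_sum_inner_le (T.map (fullOS H')) (fun k => V i (ξ k)) (fun k => V i (η k))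
  simp only [LinearIsometry.norm_map] at h
  exact h

end UltrafilterCompression

/-! ### Direct sums of contractions -/

section DirectSum

variable {X : Type*} [NormedAddCommGroup X] [NormedSpace ℂ X]

/-- A closed space of functionals contains the pointwise sums of its absolutely convergent
series. -/
theorem exists_mem_forall_apply_eq_tsum {P : Submodule ℂ (StrongDual ℂ X)}
    (hP : IsClosed (P : Set (StrongDual ℂ X))) {ι : Type*} {φ : ι → StrongDual ℂ X}
    (hφ : ∀ i, φ i ∈ P) {a : ι → ℝ} (ha : Summable a) (hφa : ∀ i, ‖φ i‖ ≤ a i) :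
    ∃ ψ ∈ P, ∀ x, ψ x = ∑' i, φ i x := by
  have hs : Summable φ := Summable.of_norm_bounded ha hφa
  refine ⟨∑' i, φ i, ?_, fun x => (ContinuousLinearMap.apply ℂ ℂ x).map_tsum hs⟩
  exact hP.mem_of_tendsto hs.hasSum (Filter.Eventually.of_forall fun s => P.sum_mem fun i _ => hφ i)

theorem exists_mem_forall_tsum_inner_eq {P : Submodule ℂ (StrongDual ℂ X)}
    (hP : IsClosed (P : Set (StrongDual ℂ X))) {ι : Type*} {H : ι → Type*}
    [∀ i, NormedAddCommGroup (H i)] [∀ i, InnerProductSpace ℂ (H i)]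
    {w : ∀ i, X →L[ℂ] (H i →L[ℂ] H i)} (hw : ∀ i, ‖w i‖ ≤ 1)
    (hwP : ∀ i ξ η, coeff (w i) ξ η ∈ P) (ξ η : lp H 2) :
    ∃ ψ ∈ P, ∀ x, ψ x = ∑' i, ⟪ξ i, w i x (η i)⟫_ℂ :=
  exists_mem_forall_apply_eq_tsum hP (fun i => hwP i (ξ i) (η i))
    (lp.summable_mul (by rw [Real.holderConjugate_iff]; norm_num) ξ η)
    (fun i => norm_coeff_le (hw i) (ξ i) (η i))

theorem exists_clm_forall_apply_eq {H : Type*} [NormedAddCommGroup H] [InnerProductSpace ℂ H]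
    (D : X → H →L[ℂ] H) (hadd : ∀ x y, D (x + y) = D x + D y)
    (hsmul : ∀ (c : ℂ) x, D (c • x) = c • D x) (hD : ∀ x, ‖D x‖ ≤ ‖x‖) :
    ∃ W : X →L[ℂ] (H →L[ℂ] H), ‖W‖ ≤ 1 ∧ ∀ x, W x = D x :=
  ⟨LinearMap.mkContinuous { toFun := D, map_add' := hadd, map_smul' := hsmul } 1
    (fun x => by rw [one_mul]; exact hD x), LinearMap.mkContinuous_norm_le _ zero_le_one _,
    fun _ => rfl⟩

/-- The block diagonal operator `⨁ i, T i` on `ℓ²(ι, H)`. -/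
noncomputable def diagonalOp {ι H : Type*} [NormedAddCommGroup H] [InnerProductSpace ℂ H]
    (T : ι → H →L[ℂ] H) {C : ℝ} (hC : 0 ≤ C) (hT : ∀ i, ‖T i‖ ≤ C) :
    lp (fun _ : ι => H) 2 →L[ℂ] lp (fun _ : ι => H) 2 :=
  lp.mapCLM 2 T hC hT

theorem diagonalOp_apply {ι H : Type*} [NormedAddCommGroup H] [InnerProductSpace ℂ H]
    (T : ι → H →L[ℂ] H) {C : ℝ} (hC : 0 ≤ C) (hT : ∀ i, ‖T i‖ ≤ C) (ξ : lp (fun _ : ι => H) 2)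
    (i : ι) : diagonalOp T hC hT ξ i = T i (ξ i) := rfl

/-- The embedding of `H` as the `i`-th summand of `ℓ²(ι, H)`. -/
noncomputable def singleIsometry {ι : Type*} [DecidableEq ι] (H : Type*) [NormedAddCommGroup H]
    [InnerProductSpace ℂ H] (i : ι) : H →ₗᵢ[ℂ] lp (fun _ : ι => H) 2 where
  toFun := fun ξ => lp.single 2 i ξ
  map_add' := fun ξ η => lp.single_add (E := fun _ => H) 2 i ξ η
  map_smul' := fun c ξ => lp.single_smul (E := fun _ => H) 2 i c ξ
  norm_map' := fun ξ => lp.norm_single (E := fun _ => H) (p := 2) two_pos i ξ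

theorem inner_singleIsometry_diagonalOp {ι : Type*} [DecidableEq ι] {H : Type*}
    [NormedAddCommGroup H] [InnerProductSpace ℂ H] (T : ι → H →L[ℂ] H) {C : ℝ} (hC : 0 ≤ C)
    (hT : ∀ i, ‖T i‖ ≤ C) (i : ι) (ξ η : H) :
    ⟪singleIsometry H i ξ, diagonalOp T hC hT (singleIsometry H i η)⟫_ℂ = ⟪ξ, T i η⟫_ℂ := by
  refine (lp.inner_single_left (G := fun _ => H) i ξ _).trans ?_
  rw [diagonalOp_apply]
  congr 2
  exact lp.single_apply_self (E := fun _ => H) 2 i η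

/-- The direct sum of a family of contractions `w i : X → B(H)` acts on `ℓ²(ι, H)`; its compressions
to the summands are the `w i`, and its coefficients are sums of series of coefficients of
the `w i`. -/
theorem exists_directSum {ι H : Type u} [NormedAddCommGroup H] [InnerProductSpace ℂ H]
    [CompleteSpace H] {P : Submodule ℂ (StrongDual ℂ X)}
    (hP : IsClosed (P : Set (StrongDual ℂ X))) {w : ι → X →L[ℂ] (H →L[ℂ] H)}
    (hw : ∀ i, ‖w i‖ ≤ 1) (hwP : ∀ i ξ η, coeff (w i) ξ η ∈ P) :
    ∃ (H' : Type u) (_ : NormedAddCommGroup H') (_ : InnerProductSpace ℂ H') (_ : CompleteSpace H')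
      (V : ι → H →ₗᵢ[ℂ] H') (W : X →L[ℂ] (H' →L[ℂ] H')), ‖W‖ ≤ 1 ∧
      (∀ i x ξ η, ⟪V i ξ, W x (V i η)⟫_ℂ = ⟪ξ, w i x η⟫_ℂ) ∧ ∀ ξ η, coeff W ξ η ∈ P := by
  classical
  have hwx : ∀ x i, ‖w i x‖ ≤ ‖x‖ := fun x i => by
    simpa using (w i).le_of_opNorm_le (hw i) x
  obtain ⟨W, hW, hWD⟩ := exists_clm_forall_apply_eq
    (fun x => diagonalOp (fun i => w i x) (norm_nonneg x) (hwx x))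
    (fun x y => by ext ξ i : 3; simp [diagonalOp_apply])
    (fun c x => by ext ξ i : 3; simp [diagonalOp_apply])
    (fun x => lp.norm_mapCLM_le 2 _ (norm_nonneg x) (hwx x))
  refine ⟨lp (fun _ : ι => H) 2, inferInstance, inferInstance, inferInstance,
    singleIsometry H, W, hW,
    fun i x ξ η => ?_, fun ξ η => ?_⟩
  · rw [hWD]
    exact inner_singleIsometry_diagonalOp (fun i => w i x) (norm_nonneg x) (hwx x) i ξ η
  · obtain ⟨ψ, hψ, h⟩ := exists_mem_forall_tsum_inner_eq hP hw hwP ξ η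
    have : coeff W ξ η = ψ := ContinuousLinearMap.ext fun x => by
      rw [h, coeff_apply, hWD]
      rfl
    rwa [this]

end DirectSum

/-! ### Normal maps -/

section Normality

variable {K : Type*} [NormedAddCommGroup K] [InnerProductSpace ℂ K] [CompleteSpace K]
  {H : Type*} [NormedAddCommGroup H] [InnerProductSpace ℂ H]

/-- A contraction whose coefficients are in the predual is normal. -/
theorem isNormalMap_of_coeff_mem_predual (M : VonNeumannAlgebra K)
    {w : M.toStarSubalgebra →L[ℂ] (H →L[ℂ] H)} (hw : ‖w‖ ≤ 1)
    (hwP : ∀ ξ η, coeff w ξ η ∈ predual M) : IsNormalMap M w := by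
  unfold IsNormalMap
  refine continuous_iInf_rng.2 fun ξ => continuous_iInf_rng.2 fun η => continuous_induced_rng.2 ?_
  obtain ⟨ψ, hψ, h⟩ := exists_mem_forall_tsum_inner_eq (isClosed_predual M)
    (w := fun _ : ℕ => w) (fun _ => hw) (fun _ => hwP) ξ η
  obtain ⟨ξ', η', h'⟩ := exists_lp_of_mem_predual M hψ
  have hfun : (fun T : H →L[ℂ] H => ∑' k, ⟪ξ k, T (η k)⟫_ℂ) ∘ w =
      (fun T : K →L[ℂ] K => ∑' k, ⟪ξ' k, T (η' k)⟫_ℂ) ∘ Subtype.val :=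
    funext fun x => (h x).symm.trans (h' x)
  rw [hfun]
  let _ : TopologicalSpace (K →L[ℂ] K) := ultraweakTopology K
  have h1 : @Continuous _ _ (ultraweakTopology K) _
      (fun T : K →L[ℂ] K => ∑' k, ⟪ξ' k, T (η' k)⟫_ℂ) :=
    continuous_iInf_dom (i := ξ') (continuous_iInf_dom (i := η') continuous_induced_dom)
  exact Continuous.comp h1 continuous_induced_dom

end Normality

end OpSpace

theorem mainTheorem8 {K : Type u} [NormedAddCommGroup K] [InnerProductSpace ℂ K]
    [CompleteSpace K] (M : VonNeumannAlgebra K) :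
    OpSpace.IsCompleteContraction (OpSpace.maxOS M.toStarSubalgebra) (OpSpace.vNOS M)
        (OpSpace.naturalMap M) ∧
      (OpSpace.RemotelyInjective M ↔
        OpSpace.FactorsThroughBH (OpSpace.maxOS M.toStarSubalgebra) (OpSpace.vNOS M)
          (OpSpace.naturalMap M)) := by
  refine ⟨OpSpace.isCompleteContraction_maxOS _ _ ContinuousLinearMap.norm_id_le, ?_, ?_⟩
  · rintro ⟨H, _, _, _, w, v, -, hw, hv, hvw⟩
    exact ⟨H, _, _, inferInstance, w, v, OpSpace.isCompleteContraction_maxOS _ w hw, hv, hvw⟩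
  · rintro ⟨H, _, _, _, u, v, hu, hv, hvu⟩
    obtain ⟨U, hU⟩ := OpSpace.exists_ultrafilter_tendsto_coeffContraction
      (OpSpace.isPredual_predual M) hu.norm_le_one
    obtain ⟨H', _, _, _, V, W, hW, hVW, hWP⟩ := OpSpace.exists_directSum
      (OpSpace.isClosed_predual M)
      (w := fun w : OpSpace.CoeffContraction (OpSpace.predual M) H => w.1)
      (fun w => w.2.1) (fun w => w.2.2)
    obtain ⟨Ψ, hΨ⟩ := OpSpace.exists_clm_tendsto_compression V U
    have hΨW : ∀ x, Ψ (W x) = u x := fun x =>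
      ContinuousLinearMap.ext fun η => ext_inner_left ℂ fun ξ =>
        tendsto_nhds_unique (hΨ (W x) ξ η) ((hU x ξ η).congr fun w => (hVW w x ξ η).symm)
    refine ⟨H', _, _, inferInstance, W, v ∘L Ψ, OpSpace.isNormalMap_of_coeff_mem_predual M hW hWP,
      hW, hv.comp (OpSpace.isCompleteContraction_of_tendsto_compression hΨ), ?_⟩
    ext1 x
    change v (Ψ (W x)) = x
    rw [hΨW]
    exact DFunLike.congr_fun hvu x
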